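/- Let $(M,g)$ be a nonempty smooth Riemannian manifold of dimension $n\ge 2$, with Levi-Civita connection having Christoffel symbols $\Gamma^k_{ij}$. On the cotangent bundle $T^*M$ use the local coordinates $(q^i,p_i)$ induced by local coordinates on $M$, and put $\frac{\delta}{\delta q^i}=\frac{\partial}{\partial q^i}+p_k\Gamma^k_{ih}\frac{\partial}{\partial p_h}$ and $t=\frac12 g^{ik}p_ip_k$ (the energy density). Let $S\subseteq(0,\infty)$ be a nonempty open set and let $T^*_SM\subseteq T^*M$ be the open set of cotangent vectors with $t\in S$; for $S=(0,\infty)$ this is the nonzero cotangent bundle $T^*_0M$, and for $S=(0,r)$ it is a tube in $T^*_0M$. Let $A\neq 0$ be a real constant and $v:S\to\mathbb R$ a smooth function with $A+2v(t)\neq 0$ for all $t\in S$, so that the matrix $$G_{ij}=At\,g_{ij}+v(t)\,p_ip_j$$ is invertible on $T^*_SM$; let $(H^{kl})$ be its inverse. Let $J$ be the almost complex structure on $T^*_SM$ given by $$J\frac{\delta}{\delta q^i}=G_{ik}\frac{\partial}{\partial p_k},\qquad J\frac{\partial}{\partial p_i}=-H^{ik}\frac{\delta}{\delta q^k}.$$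 Then $J$ is integrable, i.e. its Nijenhuis tensor $N(X,Y)=[JX,JY]-J[JX,Y]-J[X,JY]-[X,Y]$ vanishes on $T^*_SM$, if and only if there is a real constant $c$ such that $(M,g)$ has constant sectional curvature $c$ and $$v(t)=\frac{c-A^2t}{At}\qquad\text{for all } t\in S.$$ -/

import Mathlib

set_option maxSynthPendingDepth 3

open Bundle Set
open scoped Manifold ContDiff

noncomputable section

namespace CotangentJ

variable {E : Type*} [NormedAddCommGroup E] [NormedSpace ℝ E]
  {M : Type*} [TopologicalSpace M] [ChartedSpace E M] [IsManifold 𝓘(ℝ, E) ∞ M]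

/-- Smooth Riemannian metrics on a smooth manifold `M` without boundary modelled on `E`. -/
abbrev Metric (E : Type*) [NormedAddCommGroup E] [NormedSpace ℝ E]
    (M : Type*) [TopologicalSpace M] [ChartedSpace E M] [IsManifold 𝓘(ℝ, E) ∞ M] :=
  ContMDiffRiemannianMetric 𝓘(ℝ, E) ∞ E (fun x : M ↦ TangentSpace 𝓘(ℝ, E) x)

/-- The cotangent bundle `T^*M` (total space). Its topology, its charts (induced by the charts
of `M`, with coordinates `(q, p)`) and its smooth structure are Mathlib's, as bundle of
continuous linear maps from the tangent bundle to the trivial line bundle. -/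
abbrev Cotangent (E : Type*) [NormedAddCommGroup E] [NormedSpace ℝ E]
    (M : Type*) [TopologicalSpace M] [ChartedSpace E M] [IsManifold 𝓘(ℝ, E) ∞ M] :=
  TotalSpace (E →L[ℝ] ℝ)
    (fun x : M ↦ TangentSpace 𝓘(ℝ, E) x →L[ℝ] Bundle.Trivial M ℝ x)

/-- The model with corners of the cotangent bundle. -/
abbrev cotModel (E : Type*) [NormedAddCommGroup E] [NormedSpace ℝ E] :=
  𝓘(ℝ, E).prod 𝓘(ℝ, E →L[ℝ] ℝ)

/-! ### Christoffel symbols and curvature -/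

/-- The components `y ↦ (g_{ij}(y))` of the metric in the chart of `M` around `x₀`, as a function
of the coordinates `y`. -/
def chartMetric (g : Metric E M) (x₀ : M) (y : E) : E →L[ℝ] E →L[ℝ] ℝ :=
  let D : E →L[ℝ] E := mfderiv 𝓘(ℝ, E) 𝓘(ℝ, E) (extChartAt 𝓘(ℝ, E) x₀).symm y
  let B : E →L[ℝ] E →L[ℝ] ℝ := g.inner ((extChartAt 𝓘(ℝ, E) x₀).symm y)
  B.bilinearComp D D

/-- Christoffel symbols of the first kind at `y` of a field `B` of bilinear forms on `E`:
`(u, v, w) ↦ (∂_u B(v, w) + ∂_v B(u, w) - ∂_w B(u, v)) / 2`. -/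
def christoffelFirst (B : E → E →L[ℝ] E →L[ℝ] ℝ) (y : E) : E →L[ℝ] E →L[ℝ] E →L[ℝ] ℝ :=
  let d : E →L[ℝ] E →L[ℝ] E →L[ℝ] ℝ := fderiv ℝ B y
  let d' : E →L[ℝ] E →L[ℝ] E →L[ℝ] ℝ := d.flip
  let T : (E →L[ℝ] E →L[ℝ] ℝ) →L[ℝ] E →L[ℝ] E →L[ℝ] ℝ :=
    (ContinuousLinearMap.flipₗᵢ ℝ E E ℝ).toContinuousLinearEquiv.toContinuousLinearMap
  (1 / 2 : ℝ) • (d + d' - T.comp d')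

/-- Christoffel symbols `Γ^k_{ij} u^i v^j` of the Levi-Civita connection of `g`, in the chart
around `x₀` at the coordinates `y`. -/
def christoffel (g : Metric E M) (x₀ : M) (y : E) : E →L[ℝ] E →L[ℝ] E :=
  (ContinuousLinearMap.compL ℝ E (E →L[ℝ] ℝ) E (chartMetric g x₀ y).inverse).comp
    (christoffelFirst (chartMetric g x₀) y)

/-- The curvature tensor `R(u, v) w` of the Levi-Civita connection in the chart around `x₀`
at the coordinates `y`; here `R(∂_i, ∂_j) ∂_k = R^h_{kij} ∂_h`. -/
def chartCurvature (g : Metric E M) (x₀ : M) (y : E) (u v w : E) : E :=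
  fderiv ℝ (christoffel g x₀) y u v w - fderiv ℝ (christoffel g x₀) y v u w
    + christoffel g x₀ y u (christoffel g x₀ y v w)
    - christoffel g x₀ y v (christoffel g x₀ y u w)

/-- The curvature tensor of `(M, g)` at `x`. The tangent space `T_x M` is identified with `E` by
the preferred chart around `x` (this is Mathlib's definition of `TangentSpace`). -/
def curvature (g : Metric E M) (x : M) (u v w : TangentSpace 𝓘(ℝ, E) x) :
    TangentSpace 𝓘(ℝ, E) x :=
  chartCurvature (E := E) g x (extChartAt 𝓘(ℝ, E) x x) u v w

/-- `(M, g)` has constant sectional curvature `c`: for all linearly independent `u, w` in any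
tangent space, `g(R(u, w) w, u) / (g(u, u) g(w, w) - g(u, w) ^ 2) = c`. -/
def HasConstantSectionalCurvature (g : Metric E M) (c : ℝ) : Prop :=
  ∀ (x : M) (u w : TangentSpace 𝓘(ℝ, E) x), LinearIndependent ℝ ![u, w] →
    g.inner x (curvature g x u w w) u /
      (g.inner x u u * g.inner x w w - g.inner x u w ^ 2) = c

/-! ### The almost complex structure -/

/-- The energy density `t = g⁻¹(p, p) / 2` of a cotangent vector. The inverse of
`g.inner x : T_x M → T^*_x M` is the index raising map. -/
def energy (g : Metric E M) (ξ : Cotangent E M) : ℝ :=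
  1 / 2 * ξ.2 ((g.inner ξ.1).inverse ξ.2)

/-- The set of cotangent vectors with energy density in `S`. For `S = (0, ∞)` it is the nonzero
cotangent bundle `T^*_0 M`, for `S = (0, r)` a tube in it. -/
def tube (g : Metric E M) (S : Set ℝ) : Set (Cotangent E M) := {ξ | energy g ξ ∈ S}

/-- The tensor `G_{ij} = A t g_{ij} + v(t) p_i p_j` at the cotangent vector `ξ = p`,
as a map `T_x M → T^*_x M`. -/
def tensorG (g : Metric E M) (A : ℝ) (v : ℝ → ℝ) (ξ : Cotangent E M) :
    TangentSpace 𝓘(ℝ, E) ξ.1 →L[ℝ] TangentSpace 𝓘(ℝ, E) ξ.1 →L[ℝ] ℝ :=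
  let p : E →L[ℝ] ℝ := ξ.2
  let B : E →L[ℝ] E →L[ℝ] ℝ := g.inner ξ.1
  let res : E →L[ℝ] E →L[ℝ] ℝ := (A * energy g ξ) • B + v (energy g ξ) • p.smulRight p
  res

/-- The tensor `H^{kl}`, the inverse of `G_{ij}`, as a map `T^*_x M → T_x M`. -/
def tensorH (g : Metric E M) (A : ℝ) (v : ℝ → ℝ) (ξ : Cotangent E M) :
    (TangentSpace 𝓘(ℝ, E) ξ.1 →L[ℝ] ℝ) →L[ℝ] TangentSpace 𝓘(ℝ, E) ξ.1 :=
  (tensorG g A v ξ).inverse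

/-- The map `u ↦ (w ↦ p_k Γ^k_{ih} u^i w^h)`, in the preferred chart around the base point `x` of
`ξ = p`. The horizontal lift `u^i δ/δq^i` of `u` to `ξ` has coordinates `(u, horizontal g ξ u)`
in the induced chart of `T^*M`. -/
def horizontal (g : Metric E M) (ξ : Cotangent E M) : E →L[ℝ] E →L[ℝ] ℝ :=
  let p : E →L[ℝ] ℝ := ξ.2
  (ContinuousLinearMap.compL ℝ E E ℝ p).comp
    (christoffel g ξ.1 (extChartAt 𝓘(ℝ, E) ξ.1 ξ.1))

/-- The endomorphism `J` of the tangent space of `T^*M` at `ξ`, determined by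
`J (δ/δq^i) = G_{ik} ∂/∂p_k` and `J (∂/∂p_i) = - H^{ik} δ/δq^k`.
The tangent space of `T^*M` at `ξ` is identified with `E × (E →L[ℝ] ℝ)`, components along
`(∂/∂q, ∂/∂p)`, by the chart of `T^*M` induced by the preferred chart of `M` around the base point
of `ξ` (this is Mathlib's definition of `TangentSpace`). A vector `(X, P)` has horizontal part
`(X, N X)` and vertical part `(0, P - N X)` where `N = horizontal g ξ`. -/
def J (g : Metric E M) (A : ℝ) (v : ℝ → ℝ) (ξ : Cotangent E M) :
    TangentSpace (cotModel E) ξ →L[ℝ] TangentSpace (cotModel E) ξ :=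
  let G : E →L[ℝ] E →L[ℝ] ℝ := tensorG g A v ξ
  let H : (E →L[ℝ] ℝ) →L[ℝ] E := tensorH g A v ξ
  let N : E →L[ℝ] E →L[ℝ] ℝ := horizontal g ξ
  let hor : E × (E →L[ℝ] ℝ) →L[ℝ] E := ContinuousLinearMap.fst ℝ E (E →L[ℝ] ℝ)
  let ver : E × (E →L[ℝ] ℝ) →L[ℝ] (E →L[ℝ] ℝ) :=
    ContinuousLinearMap.snd ℝ E (E →L[ℝ] ℝ) - N.comp hor
  let res : E × (E →L[ℝ] ℝ) →L[ℝ] E × (E →L[ℝ] ℝ) :=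
    (-(H.comp ver)).prod (G.comp hor - N.comp (H.comp ver))
  res

/-! ### Integrability -/

/-- The Nijenhuis tensor `[KX, KY] - K[KX, Y] - K[X, KY] - [X, Y]` of a field `K` of endomorphisms
of the tangent spaces of `T^*M`, evaluated on the vector fields `X`, `Y` at the point `ξ`. -/
def nijenhuis
    (K : ∀ ξ : Cotangent E M, TangentSpace (cotModel E) ξ →L[ℝ] TangentSpace (cotModel E) ξ)
    (X Y : ∀ ξ : Cotangent E M, TangentSpace (cotModel E) ξ) (ξ : Cotangent E M) :
    TangentSpace (cotModel E) ξ :=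
  VectorField.mlieBracket (cotModel E) (fun η ↦ K η (X η)) (fun η ↦ K η (Y η)) ξ
    - K ξ (VectorField.mlieBracket (cotModel E) (fun η ↦ K η (X η)) Y ξ)
    - K ξ (VectorField.mlieBracket (cotModel E) X (fun η ↦ K η (Y η)) ξ)
    - VectorField.mlieBracket (cotModel E) X Y ξ

/-- The almost complex structure `K` on the open set `U` of `T^*M` is integrable: its Nijenhuis
tensor vanishes, i.e. is zero on all smooth vector fields on open subsets of `U`. -/
def IsIntegrableOn
    (K : ∀ ξ : Cotangent E M, TangentSpace (cotModel E) ξ →L[ℝ] TangentSpace (cotModel E) ξ)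
    (U : Set (Cotangent E M)) : Prop :=
  ∀ V : Set (Cotangent E M), IsOpen V → V ⊆ U →
    ∀ X Y : ∀ ξ : Cotangent E M, TangentSpace (cotModel E) ξ,
      ContMDiffOn (cotModel E) (cotModel E).tangent ∞
        (fun ξ ↦ (⟨ξ, X ξ⟩ : TangentBundle (cotModel E) (Cotangent E M))) V →
      ContMDiffOn (cotModel E) (cotModel E).tangent ∞
        (fun ξ ↦ (⟨ξ, Y ξ⟩ : TangentBundle (cotModel E) (Cotangent E M))) V →
      ∀ ξ ∈ V, nijenhuis K X Y ξ = 0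

end CotangentJ

end

/-! The Nijenhuis tensor `N` is tensorial because `J² = -1`, and differentiating `J² = -1` gives
`N(JX, Y) = -J N(X, Y)`. Every tangent vector of `T^*M` is a sum `δ_u + J δ_w` with `δ_u`, `δ_w`
horizontal lifts, so `N` vanishes as soon as it vanishes on pairs of horizontal lifts.

For such a pair the mixed brackets `[J δ_u, δ_w]` and `[δ_u, J δ_w]` cancel, since `G` is built from
the horizontally parallel objects `g`, `p`, `t` and the connection is torsion-free. What remains is
`[J δ_u, J δ_w] - [δ_u, δ_w]`, a vertical vector. The second bracket is the curvature contracted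
with `p`. In the first, antisymmetry in `u`, `w` removes `v'` and leaves the coefficient `A t (A +
v(t))`. Hence (`IsMetricOn.localNijenhuis_eq_zero_iff`) integrability at `p` means `p(R(u, w) x) = A
t (A + v(t)) (p(u) g(w, x) - p(w) g(u, x))`.

On one energy level `t₀ ∈ S` a multiple of every nonzero covector of every fibre is available, so
`R` has the constant curvature form with `c = A t₀ (A + v(t₀))`. This number is the same at all
points of `M`, so Schur's lemma is not needed. Comparing levels in dimension at least two gives `A t
(A + v(t)) = c` on all of `S`, which is the formula for `v`. The converse is substitution, once
constant sectional curvature is known to determine `R` (`hasConstantSectionalCurvature_iff`).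

The computation is done on an open subset of `E × E^*`. Its transfer to `T^*M` (`nijenhuis_J_eq`)
rests on the naturality of `J` under changes of coordinates, because the definition of `J` uses a
different chart at each point. -/

noncomputable section

namespace CotangentJ

open Filter Topology

/-! ### Metrics and their Levi-Civita connections on an open subset of `E` -/

section LocalModel

variable {E : Type*} [NormedAddCommGroup E] [NormedSpace ℝ E]

/-- The Levi-Civita Christoffel symbols of a field `B` of bilinear forms on `E`. -/
def leviCivita (B : E → E →L[ℝ] E →L[ℝ] ℝ) (y : E) : E →L[ℝ] E →L[ℝ] E :=
  (ContinuousLinearMap.compL ℝ E (E →L[ℝ] ℝ) E (B y).inverse).comp (christoffelFirst B y)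

lemma leviCivita_apply (B : E → E →L[ℝ] E →L[ℝ] ℝ) (y u w : E) :
    leviCivita B y u w = (B y).inverse (christoffelFirst B y u w) := rfl

lemma christoffelFirst_apply (B : E → E →L[ℝ] E →L[ℝ] ℝ) (y u v w : E) :
    christoffelFirst B y u v w =
      1 / 2 * (fderiv ℝ B y u v w + fderiv ℝ B y v u w - fderiv ℝ B y w u v) := by
  simp only [christoffelFirst]
  rfl

/-- The energy density in coordinates `z = (q, p)`. -/
def localEnergy (B : E → E →L[ℝ] E →L[ℝ] ℝ) (z : E × (E →L[ℝ] ℝ)) : ℝ :=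
  1 / 2 * z.2 ((B z.1).inverse z.2)

/-- The tensor `G` in coordinates `z = (q, p)`. -/
def localG (B : E → E →L[ℝ] E →L[ℝ] ℝ) (A : ℝ) (v : ℝ → ℝ) (z : E × (E →L[ℝ] ℝ)) :
    E →L[ℝ] E →L[ℝ] ℝ :=
  (A * localEnergy B z) • B z.1 + v (localEnergy B z) • z.2.smulRight z.2

lemma localG_apply (B : E → E →L[ℝ] E →L[ℝ] ℝ) (A : ℝ) (v : ℝ → ℝ) (z : E × (E →L[ℝ] ℝ))
    (u w : E) : localG B A v z u w =
      A * localEnergy B z * B z.1 u w + v (localEnergy B z) * (z.2 u * z.2 w) := rfl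

/-- The horizontal lift in coordinates `z = (q, p)`: `(u, w) ↦ p (Γ (u, w))`. -/
def localN (B : E → E →L[ℝ] E →L[ℝ] ℝ) (z : E × (E →L[ℝ] ℝ)) : E →L[ℝ] E →L[ℝ] ℝ :=
  (ContinuousLinearMap.compL ℝ E E ℝ z.2).comp (leviCivita B z.1)

lemma localN_apply (B : E → E →L[ℝ] E →L[ℝ] ℝ) (z : E × (E →L[ℝ] ℝ)) (u w : E) :
    localN B z u w = z.2 (leviCivita B z.1 u w) := rfl

/-- The endomorphism of `E × E^*` exchanging horizontal and vertical vectors by means of `G` and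
`-H`, where the horizontal vectors are the `(u, N u)`. -/
def swapOperator (G : E →L[ℝ] E →L[ℝ] ℝ) (H : (E →L[ℝ] ℝ) →L[ℝ] E) (N : E →L[ℝ] E →L[ℝ] ℝ) :
    E × (E →L[ℝ] ℝ) →L[ℝ] E × (E →L[ℝ] ℝ) :=
  let hor : E × (E →L[ℝ] ℝ) →L[ℝ] E := ContinuousLinearMap.fst ℝ E (E →L[ℝ] ℝ)
  let ver : E × (E →L[ℝ] ℝ) →L[ℝ] (E →L[ℝ] ℝ) :=
    ContinuousLinearMap.snd ℝ E (E →L[ℝ] ℝ) - N.comp hor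
  (-(H.comp ver)).prod (G.comp hor - N.comp (H.comp ver))

lemma swapOperator_apply (G : E →L[ℝ] E →L[ℝ] ℝ) (H : (E →L[ℝ] ℝ) →L[ℝ] E)
    (N : E →L[ℝ] E →L[ℝ] ℝ) (a : E × (E →L[ℝ] ℝ)) :
    swapOperator G H N a = (-H (a.2 - N a.1), G a.1 - N (H (a.2 - N a.1))) := rfl

/-- The endomorphism `J` in coordinates `z = (q, p)`. -/
def localJ (B : E → E →L[ℝ] E →L[ℝ] ℝ) (A : ℝ) (v : ℝ → ℝ) (z : E × (E →L[ℝ] ℝ)) :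
    E × (E →L[ℝ] ℝ) →L[ℝ] E × (E →L[ℝ] ℝ) :=
  swapOperator (localG B A v z) (localG B A v z).inverse (localN B z)

lemma localJ_horizontal (B : E → E →L[ℝ] E →L[ℝ] ℝ) (A : ℝ) (v : ℝ → ℝ)
    (z : E × (E →L[ℝ] ℝ)) (u : E) :
    localJ B A v z (u, localN B z u) = (0, localG B A v z u) := by
  simp [localJ, swapOperator_apply]

/-- A field of bilinear forms which is a Riemannian metric on the open set `W`. -/
structure IsMetricOn (B : E → E →L[ℝ] E →L[ℝ] ℝ) (W : Set E) : Prop where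
  isOpen : IsOpen W
  contDiffOn : ContDiffOn ℝ ∞ B W
  symm : ∀ y ∈ W, ∀ u w, B y u w = B y w u
  pos : ∀ y ∈ W, ∀ u, u ≠ 0 → 0 < B y u u

variable {B : E → E →L[ℝ] E →L[ℝ] ℝ} {W : Set E} {y : E}

lemma IsMetricOn.contDiffAt (hB : IsMetricOn B W) (hy : y ∈ W) : ContDiffAt ℝ ∞ B y :=
  hB.contDiffOn.contDiffAt (hB.isOpen.mem_nhds hy)

lemma IsMetricOn.differentiableAt (hB : IsMetricOn B W) (hy : y ∈ W) : DifferentiableAt ℝ B y :=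
  (hB.contDiffAt hy).differentiableAt (by simp)

lemma IsMetricOn.fderiv_symm (hB : IsMetricOn B W) (hy : y ∈ W) (u v w : E) :
    fderiv ℝ B y u v w = fderiv ℝ B y u w v := by
  have h : (fun x => B x v w) =ᶠ[𝓝 y] fun x => B x w v := by
    filter_upwards [hB.isOpen.mem_nhds hy] with x hx using hB.symm x hx v w
  have hd := (hB.differentiableAt hy).hasFDerivAt
  have key : ∀ v w : E, fderiv ℝ (fun x => B x v w) y u = fderiv ℝ B y u v w := by
    intro v w
    have := ((hd.clm_apply (hasFDerivAt_const v y)).clm_apply (hasFDerivAt_const w y))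
    rw [this.fderiv]
    simp
  rw [← key, ← key, h.fderiv_eq]

section FiniteDimensional

variable [FiniteDimensional ℝ E]

/-- `E` and its dual have the same finite dimension. Invertibility has to be established wherever an
`inverse` is used, since the default value of `inverse` is `0`. -/
lemma isInvertible_of_injective {b : E →L[ℝ] E →L[ℝ] ℝ} (h : ∀ u, b u = 0 → u = 0) :
    b.IsInvertible := by
  have hr : Module.finrank ℝ E = Module.finrank ℝ (E →L[ℝ] ℝ) := by
    rw [← (LinearMap.toContinuousLinearMap (𝕜 := ℝ) (E := E) (F' := ℝ)).finrank_eq]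
    exact (Subspace.dual_finrank_eq (K := ℝ) (V := E)).symm
  have hi : Function.Injective (b : E →ₗ[ℝ] E →L[ℝ] ℝ) :=
    (injective_iff_map_eq_zero _).2 h
  let e := (LinearEquiv.ofInjectiveOfFinrankEq
    (b : E →ₗ[ℝ] E →L[ℝ] ℝ) hi hr).toContinuousLinearEquiv
  exact ⟨e, by ext u w; rfl⟩

lemma IsMetricOn.isInvertible (hB : IsMetricOn B W) (hy : y ∈ W) : (B y).IsInvertible := by
  refine isInvertible_of_injective fun u hu => ?_
  by_contra h
  have := hB.pos y hy u h
  simp [hu] at this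

/-- Koszul's formula; symmetry, metric compatibility and the transformation law of the connection
are all read off from it. -/
lemma IsMetricOn.leviCivita_lower (hB : IsMetricOn B W) (hy : y ∈ W) (u v w : E) :
    B y (leviCivita B y u v) w =
      1 / 2 * (fderiv ℝ B y u v w + fderiv ℝ B y v u w - fderiv ℝ B y w u v) := by
  rw [leviCivita_apply, (hB.isInvertible hy).self_apply_inverse, christoffelFirst_apply]

lemma IsMetricOn.ext (hB : IsMetricOn B W) (hy : y ∈ W) {u v : E}
    (h : ∀ w, B y u w = B y v w) : u = v := by
  obtain ⟨e, he⟩ := hB.isInvertible hy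
  apply e.injective
  ext w
  simpa [← he] using h w

lemma IsMetricOn.leviCivita_symm (hB : IsMetricOn B W) (hy : y ∈ W) (u v : E) :
    leviCivita B y u v = leviCivita B y v u := by
  refine hB.ext hy fun w => ?_
  rw [hB.leviCivita_lower hy, hB.leviCivita_lower hy, hB.fderiv_symm hy w u v]
  ring

/-- The Levi-Civita connection is compatible with the metric. -/
lemma IsMetricOn.fderiv_eq (hB : IsMetricOn B W) (hy : y ∈ W) (u v w : E) :
    fderiv ℝ B y u v w = B y (leviCivita B y u v) w + B y v (leviCivita B y u w) := by
  rw [hB.symm y hy v, hB.leviCivita_lower hy, hB.leviCivita_lower hy, hB.fderiv_symm hy u w v]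
  ring

lemma IsMetricOn.contDiffAt_inverse (hB : IsMetricOn B W) (hy : y ∈ W) :
    ContDiffAt ℝ ∞ (fun x => (B x).inverse) y :=
  (hB.isInvertible hy).contDiffAt_map_inverse.comp y (hB.contDiffAt hy)

lemma IsMetricOn.contDiffAt_leviCivita (hB : IsMetricOn B W) (hy : y ∈ W) :
    ContDiffAt ℝ ∞ (leviCivita B) y := by
  have hd : ContDiffAt ℝ ∞ (fderiv ℝ B) y := (hB.contDiffAt hy).fderiv_right (by simp)
  have hflip : ContDiff ℝ ∞
      (fun d : E →L[ℝ] E →L[ℝ] E →L[ℝ] ℝ => d.flip) :=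
    (ContinuousLinearMap.flipₗᵢ ℝ E E (E →L[ℝ] ℝ)).toContinuousLinearEquiv.contDiff
  have hd' : ContDiffAt ℝ ∞ (fun x => (fderiv ℝ B x).flip) y := hflip.contDiffAt.comp y hd
  have h1 : ContDiffAt ℝ ∞ (christoffelFirst B) y := by
    unfold christoffelFirst
    exact ((hd.add hd').sub (contDiffAt_const.clm_comp hd')).const_smul (1 / 2 : ℝ)
  unfold leviCivita
  exact (((ContinuousLinearMap.compL ℝ E (E →L[ℝ] ℝ) E).contDiff.contDiffAt.comp y
    (hB.contDiffAt_inverse hy))).clm_comp h1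

end FiniteDimensional

end LocalModel

/-! ### Invertibility and smoothness of `G` and `J` in coordinates -/

section LocalModel

variable {E : Type*} [NormedAddCommGroup E] [NormedSpace ℝ E] [FiniteDimensional ℝ E]
  {B : E → E →L[ℝ] E →L[ℝ] ℝ} {W : Set E} {z : E × (E →L[ℝ] ℝ)} {A : ℝ} {v : ℝ → ℝ}

lemma IsMetricOn.apply_inverse (hB : IsMetricOn B W) (hz : z.1 ∈ W) (P : E →L[ℝ] ℝ) (w : E) :
    B z.1 ((B z.1).inverse P) w = P w := by
  rw [(hB.isInvertible hz).self_apply_inverse]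

/-- The energy is half the squared length of the vector `B⁻¹ p`, which is zero only for `p = 0`. -/
lemma IsMetricOn.localEnergy_pos_iff (hB : IsMetricOn B W) (hz : z.1 ∈ W) :
    0 < localEnergy B z ↔ z.2 ≠ 0 := by
  have h := hB.apply_inverse hz z.2 ((B z.1).inverse z.2)
  constructor
  · rintro h1 h2
    simp [localEnergy, h2] at h1
  · intro h2
    have h3 : (B z.1).inverse z.2 ≠ 0 := by
      intro h3
      apply h2
      ext w
      rw [← hB.apply_inverse hz, h3]
      simp
    have := hB.pos _ hz _ h3
    rw [h] at this
    simpa [localEnergy] using this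

/-- If `G u = 0`, evaluation on `e = B⁻¹ p` gives `t (A + 2 v) p(u) = 0`, so `p(u) = 0`; then `G(u,
u) = A t B(u, u)` forces `u = 0`. -/
lemma IsMetricOn.isInvertible_localG (hB : IsMetricOn B W) (hz : z.1 ∈ W) (hA : A ≠ 0)
    (ht : 0 < localEnergy B z) (hv : A + 2 * v (localEnergy B z) ≠ 0) :
    (localG B A v z).IsInvertible := by
  refine isInvertible_of_injective fun u hu => ?_
  set t := localEnergy B z with htdef
  set e := (B z.1).inverse z.2 with he
  have he2 : z.2 e = 2 * t := by rw [htdef, localEnergy, ← he]; ring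
  have hpu : z.2 u = 0 := by
    have h1 : localG B A v z u e = 0 := by rw [hu]; simp
    rw [localG_apply, ← htdef, hB.symm _ hz, hB.apply_inverse hz, he2] at h1
    have h2 : t * (A + 2 * v t) * z.2 u = 0 := by linear_combination h1
    simpa [ht.ne', hv] using h2
  have h2 : localG B A v z u u = 0 := by rw [hu]; simp
  rw [localG_apply, hpu, ← htdef] at h2
  by_contra hne
  have := hB.pos _ hz _ hne
  simp [hA, ht.ne', this.ne'] at h2

omit [FiniteDimensional ℝ E] in
lemma IsMetricOn.contDiffAt_comp_fst (hB : IsMetricOn B W) (hz : z.1 ∈ W) :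
    ContDiffAt ℝ ∞ (fun x : E × (E →L[ℝ] ℝ) => B x.1) z :=
  (hB.contDiffAt hz).comp z contDiffAt_fst

lemma IsMetricOn.contDiffAt_localEnergy (hB : IsMetricOn B W) (hz : z.1 ∈ W) :
    ContDiffAt ℝ ∞ (localEnergy B) z := by
  unfold localEnergy
  have h : ContDiffAt ℝ ∞ (fun x : E × (E →L[ℝ] ℝ) => (B x.1).inverse) z :=
    (hB.contDiffAt_inverse hz).comp z contDiffAt_fst
  exact contDiffAt_const.mul (contDiffAt_snd.clm_apply (h.clm_apply contDiffAt_snd))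

lemma IsMetricOn.contDiffAt_localN (hB : IsMetricOn B W) (hz : z.1 ∈ W) :
    ContDiffAt ℝ ∞ (localN B) z := by
  unfold localN
  have h : ContDiffAt ℝ ∞ (fun x : E × (E →L[ℝ] ℝ) => leviCivita B x.1) z :=
    (hB.contDiffAt_leviCivita hz).comp z contDiffAt_fst
  exact ((ContinuousLinearMap.compL ℝ E E ℝ).contDiff.contDiffAt.comp z
    contDiffAt_snd).clm_comp h

lemma IsMetricOn.contDiffAt_localG (hB : IsMetricOn B W) (hz : z.1 ∈ W)
    (hv : ContDiffAt ℝ ∞ v (localEnergy B z)) :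
    ContDiffAt ℝ ∞ (localG B A v) z := by
  have ht := hB.contDiffAt_localEnergy hz
  have hvt : ContDiffAt ℝ ∞ (fun x => v (localEnergy B x)) z := hv.comp z ht
  exact ((contDiffAt_const.mul ht).smul (hB.contDiffAt_comp_fst hz)).add
    (hvt.smul (contDiffAt_snd.smulRight contDiffAt_snd))

omit [FiniteDimensional ℝ E] in
lemma contDiffAt_swapOperator {F : Type*} [NormedAddCommGroup F] [NormedSpace ℝ F] {x : F}
    {G : F → E →L[ℝ] E →L[ℝ] ℝ} {H : F → (E →L[ℝ] ℝ) →L[ℝ] E} {N : F → E →L[ℝ] E →L[ℝ] ℝ}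
    (hG : ContDiffAt ℝ ∞ G x) (hH : ContDiffAt ℝ ∞ H x) (hN : ContDiffAt ℝ ∞ N x) :
    ContDiffAt ℝ ∞ (fun x => swapOperator (G x) (H x) (N x)) x := by
  unfold swapOperator
  have hver := (contDiffAt_const (c := ContinuousLinearMap.snd ℝ E (E →L[ℝ] ℝ)) (x := x)).sub
    (hN.clm_comp (contDiffAt_const (c := ContinuousLinearMap.fst ℝ E (E →L[ℝ] ℝ))))
  have hHv := hH.clm_comp hver
  have h2 := (hG.clm_comp
    (contDiffAt_const (c := ContinuousLinearMap.fst ℝ E (E →L[ℝ] ℝ)))).sub (hN.clm_comp hHv)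
  -- Splitting the product through the two injections reduces smoothness to that of compositions and
  -- sums.
  have hp : ∀ (f : E × (E →L[ℝ] ℝ) →L[ℝ] E) (g : E × (E →L[ℝ] ℝ) →L[ℝ] E →L[ℝ] ℝ),
      f.prod g = (ContinuousLinearMap.inl ℝ E (E →L[ℝ] ℝ)).comp f
        + (ContinuousLinearMap.inr ℝ E (E →L[ℝ] ℝ)).comp g := by
    intro f g
    ext <;> simp
  simp only [hp]
  exact (contDiffAt_const.clm_comp hHv.neg).add (contDiffAt_const.clm_comp h2)

lemma IsMetricOn.contDiffAt_localJ (hB : IsMetricOn B W) (hz : z.1 ∈ W)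
    (hv : ContDiffAt ℝ ∞ v (localEnergy B z)) (hG : (localG B A v z).IsInvertible) :
    ContDiffAt ℝ ∞ (localJ B A v) z := by
  have h := hB.contDiffAt_localG (A := A) hz hv
  exact contDiffAt_swapOperator h (hG.contDiffAt_map_inverse.comp z h) (hB.contDiffAt_localN hz)

omit [FiniteDimensional ℝ E] in
lemma localJ_localJ (hG : (localG B A v z).IsInvertible) (a : E × (E →L[ℝ] ℝ)) :
    localJ B A v z (localJ B A v z a) = -a := by
  simp only [localJ, swapOperator_apply]
  ext1
  · simp [hG.inverse_apply_self]
    abel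
  · simp [hG.self_apply_inverse, hG.inverse_apply_self]
    abel

/-! ### Derivatives in horizontal and vertical directions -/

lemma IsMetricOn.fderiv_localEnergy (hB : IsMetricOn B W) (hz : z.1 ∈ W)
    (a : E × (E →L[ℝ] ℝ)) :
    fderiv ℝ (localEnergy B) z a = a.2 ((B z.1).inverse z.2)
      - 1 / 2 * fderiv ℝ B z.1 a.1 ((B z.1).inverse z.2) ((B z.1).inverse z.2) := by
  set e : E × (E →L[ℝ] ℝ) → E := fun x => (B x.1).inverse x.2 with he
  have hed : DifferentiableAt ℝ e z :=
    (((hB.contDiffAt_inverse hz).comp z contDiffAt_fst).clm_apply contDiffAt_snd).differentiableAt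
      (by simp)
  have hBd : HasFDerivAt (fun x : E × (E →L[ℝ] ℝ) => B x.1)
      ((fderiv ℝ B z.1).comp (ContinuousLinearMap.fst ℝ E (E →L[ℝ] ℝ))) z :=
    (hB.differentiableAt hz).hasFDerivAt.comp z hasFDerivAt_fst
  have h1 : HasFDerivAt (localEnergy B) _ z :=
    (hasFDerivAt_snd.clm_apply hed.hasFDerivAt).const_mul (1 / 2 : ℝ)
  have h2 := (hBd.clm_apply hed.hasFDerivAt).clm_apply (hasFDerivAt_const (e z) z)
  -- The derivative of `B⁻¹` is avoided: with the last argument frozen at `e z`, differentiating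
  -- `B(e, e z) = p(e z)` determines `p(De)`.
  have h3 : (fun x => B x.1 (e x) (e z)) =ᶠ[𝓝 z] fun x => x.2 (e z) := by
    filter_upwards [continuousAt_fst.preimage_mem_nhds (hB.isOpen.mem_nhds hz)] with x hx
    exact hB.apply_inverse hx _ _
  have h4 : HasFDerivAt (fun x : E × (E →L[ℝ] ℝ) => x.2 (e z)) _ z :=
    hasFDerivAt_snd.clm_apply (hasFDerivAt_const (e z) z)
  have h5 := congrArg (fun f => f a) ((h4.congr_of_eventuallyEq h3).unique h2)
  rw [h1.fderiv]
  simp at h5 ⊢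
  have h6 : B z.1 (fderiv ℝ e z a) (e z) = z.2 (fderiv ℝ e z a) := by
    rw [hB.symm _ hz, hB.apply_inverse hz]
  rw [h6] at h5
  linear_combination (-1 / 2 : ℝ) * h5

/-- Parallel transport preserves length: metric compatibility turns the derivative of `B` into
exactly twice the connection term. -/
lemma IsMetricOn.fderiv_localEnergy_horizontal (hB : IsMetricOn B W) (hz : z.1 ∈ W) (u : E) :
    fderiv ℝ (localEnergy B) z (u, localN B z u) = 0 := by
  rw [hB.fderiv_localEnergy hz, localN_apply, hB.fderiv_eq hz, hB.symm _ hz _ (leviCivita _ _ _ _),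
    hB.symm _ hz (leviCivita _ _ _ _), hB.apply_inverse hz]
  ring

lemma IsMetricOn.fderiv_localEnergy_vertical (hB : IsMetricOn B W) (hz : z.1 ∈ W)
    (P : E →L[ℝ] ℝ) :
    fderiv ℝ (localEnergy B) z (0, P) = P ((B z.1).inverse z.2) := by
  rw [hB.fderiv_localEnergy hz]
  simp

lemma IsMetricOn.fderiv_localG (hB : IsMetricOn B W) (hz : z.1 ∈ W)
    (hv : ContDiffAt ℝ ∞ v (localEnergy B z)) (a : E × (E →L[ℝ] ℝ)) (u w : E) :
    fderiv ℝ (localG B A v) z a u w =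
      A * fderiv ℝ (localEnergy B) z a * B z.1 u w
      + A * localEnergy B z * fderiv ℝ B z.1 a.1 u w
      + deriv v (localEnergy B z) * fderiv ℝ (localEnergy B) z a * (z.2 u * z.2 w)
      + v (localEnergy B z) * (a.2 u * z.2 w + z.2 u * a.2 w) := by
  have hGd := ((hB.contDiffAt_localG (A := A) hz hv).differentiableAt (by simp)).hasFDerivAt
  have h1 := (hGd.clm_apply (hasFDerivAt_const u z)).clm_apply (hasFDerivAt_const w z)
  have ht := ((hB.contDiffAt_localEnergy hz).differentiableAt (by simp)).hasFDerivAt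
  have hBd : HasFDerivAt (fun x : E × (E →L[ℝ] ℝ) => B x.1)
      ((fderiv ℝ B z.1).comp (ContinuousLinearMap.fst ℝ E (E →L[ℝ] ℝ))) z :=
    (hB.differentiableAt hz).hasFDerivAt.comp z hasFDerivAt_fst
  have hBd := (hBd.clm_apply (hasFDerivAt_const u z)).clm_apply (hasFDerivAt_const w z)
  have hvd : HasFDerivAt (fun x => v (localEnergy B x)) _ z :=
    ((hv.differentiableAt (by simp)).hasDerivAt).comp_hasFDerivAt z ht
  have hp : ∀ u : E, HasFDerivAt (fun x : E × (E →L[ℝ] ℝ) => x.2 u) _ z := fun u =>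
    hasFDerivAt_snd.clm_apply (hasFDerivAt_const u z)
  have h2 := ((ht.const_mul A).mul hBd).add (hvd.mul ((hp u).mul (hp w)))
  have h3 := congrArg (fun f => f a) (h1.unique h2)
  simp at h3
  rw [h3]
  ring

/-- `G` is horizontally parallel: `t` is constant in horizontal directions, and `B` and `p ⊗ p`
contribute only connection terms. -/
lemma IsMetricOn.fderiv_localG_horizontal (hB : IsMetricOn B W) (hz : z.1 ∈ W)
    (hv : ContDiffAt ℝ ∞ v (localEnergy B z)) (a u w : E) :
    fderiv ℝ (localG B A v) z (a, localN B z a) u w =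
      localG B A v z (leviCivita B z.1 a u) w + localG B A v z u (leviCivita B z.1 a w) := by
  rw [hB.fderiv_localG hz hv, hB.fderiv_localEnergy_horizontal hz, hB.fderiv_eq hz]
  simp only [localG_apply, localN_apply]
  ring

lemma IsMetricOn.fderiv_localN (hB : IsMetricOn B W) (hz : z.1 ∈ W) (a : E × (E →L[ℝ] ℝ))
    (u w : E) :
    fderiv ℝ (localN B) z a u w =
      a.2 (leviCivita B z.1 u w) + z.2 (fderiv ℝ (leviCivita B) z.1 a.1 u w) := by
  have hNd := ((hB.contDiffAt_localN hz).differentiableAt (by simp)).hasFDerivAt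
  have h1 := (hNd.clm_apply (hasFDerivAt_const u z)).clm_apply (hasFDerivAt_const w z)
  have hΓ : HasFDerivAt (fun x : E × (E →L[ℝ] ℝ) => leviCivita B x.1)
      ((fderiv ℝ (leviCivita B) z.1).comp (ContinuousLinearMap.fst ℝ E (E →L[ℝ] ℝ))) z :=
    (((hB.contDiffAt_leviCivita hz).differentiableAt (by simp)).hasFDerivAt).comp z
      hasFDerivAt_fst
  have h2 := hasFDerivAt_snd.clm_apply
    ((hΓ.clm_apply (hasFDerivAt_const u z)).clm_apply (hasFDerivAt_const w z))
  have h3 := congrArg (fun f => f a) (h1.unique h2)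
  simp at h3
  rw [h3]
  ring

/-- The curvature tensor in coordinates. -/
def localCurvature (B : E → E →L[ℝ] E →L[ℝ] ℝ) (y : E) (u v w : E) : E :=
  fderiv ℝ (leviCivita B) y u v w - fderiv ℝ (leviCivita B) y v u w
    + leviCivita B y u (leviCivita B y v w) - leviCivita B y v (leviCivita B y u w)

/-- `[δ_u, δ_w]` is vertical and given by the curvature. -/
lemma IsMetricOn.fderiv_localN_horizontal_sub (hB : IsMetricOn B W) (hz : z.1 ∈ W)
    (u w x : E) :
    fderiv ℝ (localN B) z (u, localN B z u) w x - fderiv ℝ (localN B) z (w, localN B z w) u x =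
      z.2 (localCurvature B z.1 u w x) := by
  simp only [hB.fderiv_localN hz, localN_apply, localCurvature, map_add, map_sub]
  ring

/-- `[J δ_u, J δ_w]` is vertical, and given by the following expression. -/
lemma IsMetricOn.fderiv_localG_vertical_sub (hB : IsMetricOn B W) (hz : z.1 ∈ W)
    (hv : ContDiffAt ℝ ∞ v (localEnergy B z)) (u w x : E) :
    fderiv ℝ (localG B A v) z (0, localG B A v z u) w x
      - fderiv ℝ (localG B A v) z (0, localG B A v z w) u x =
      A * localEnergy B z * (A + v (localEnergy B z)) *
        (z.2 u * B z.1 w x - z.2 w * B z.1 u x) := by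
  have he : z.2 ((B z.1).inverse z.2) = 2 * localEnergy B z := by rw [localEnergy]; ring
  -- This is the derivative of the energy along `J δ_u`. It is a multiple of `p(u)`, so the `v'`
  -- term is symmetric in `u`, `w` and drops out.
  have hG : ∀ u, localG B A v z u ((B z.1).inverse z.2) =
      localEnergy B z * (A + 2 * v (localEnergy B z)) * z.2 u := by
    intro u
    rw [localG_apply, hB.symm _ hz, hB.apply_inverse hz, he]
    ring
  simp only [hB.fderiv_localG hz hv, hB.fderiv_localEnergy_vertical hz, hG, localG_apply, map_zero,
    zero_apply]
  rw [hB.symm _ hz w u]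
  ring

end LocalModel

/-! ### The Nijenhuis tensor of a field of endomorphisms of a vector space -/

section Nijenhuis

variable {F : Type*} [NormedAddCommGroup F] [NormedSpace ℝ F] {K : F → F →L[ℝ] F} {x : F}

/-- The Nijenhuis tensor of a field of endomorphisms of a vector space. -/
def localNijenhuis (K : F → F →L[ℝ] F) (x a b : F) : F :=
  fderiv ℝ K x (K x a) b - fderiv ℝ K x (K x b) a
    + K x (fderiv ℝ K x b a) - K x (fderiv ℝ K x a b)

lemma localNijenhuis_add_left (a a' b : F) :
    localNijenhuis K x (a + a') b = localNijenhuis K x a b + localNijenhuis K x a' b := by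
  simp only [localNijenhuis, map_add, _root_.add_apply]
  abel

lemma localNijenhuis_swap (a b : F) :
    localNijenhuis K x b a = -localNijenhuis K x a b := by
  simp only [localNijenhuis]
  abel

/-- Tensoriality: all terms containing derivatives of `X` or `Y` cancel by `K² = -1` at the single
point `x`. -/
lemma lieBracket_eq_localNijenhuis {X Y : F → F} (hK : DifferentiableAt ℝ K x)
    (hKK : ∀ a, K x (K x a) = -a) (hX : DifferentiableAt ℝ X x) (hY : DifferentiableAt ℝ Y x) :
    VectorField.lieBracket ℝ (fun y => K y (X y)) (fun y => K y (Y y)) x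
      - K x (VectorField.lieBracket ℝ (fun y => K y (X y)) Y x)
      - K x (VectorField.lieBracket ℝ X (fun y => K y (Y y)) x)
      - VectorField.lieBracket ℝ X Y x = localNijenhuis K x (X x) (Y x) := by
  have h : ∀ {Z : F → F}, DifferentiableAt ℝ Z x → ∀ c, fderiv ℝ (fun y => K y (Z y)) x c =
      K x (fderiv ℝ Z x c) + fderiv ℝ K x c (Z x) := by
    intro Z hZ c
    rw [(hK.hasFDerivAt.clm_apply hZ.hasFDerivAt).fderiv]
    simp
  simp only [VectorField.lieBracket, h hX, h hY, map_sub, map_add, hKK, localNijenhuis]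
  abel

lemma localNijenhuis_apply_left (hK : DifferentiableAt ℝ K x)
    (hKK : ∀ᶠ y in 𝓝 x, ∀ a, K y (K y a) = -a) (a b : F) :
    localNijenhuis K x (K x a) b = -K x (localNijenhuis K x a b) := by
  -- Differentiating `K² = -1`, which therefore has to hold near `x`, shows that `DK` anticommutes
  -- with `K`.
  have h : ∀ c a, fderiv ℝ K x c (K x a) = -K x (fderiv ℝ K x c a) := by
    intro c a
    have h1 := hK.hasFDerivAt.clm_apply (hK.hasFDerivAt.clm_apply (hasFDerivAt_const a x))
    have h2 : (fun y => K y (K y a)) =ᶠ[𝓝 x] fun _ => -a := by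
      filter_upwards [hKK] with y hy using hy a
    have h3 := congrArg (fun f => f c)
      (((hasFDerivAt_const (-a) x).congr_of_eventuallyEq h2).unique h1)
    simp at h3
    rw [eq_neg_iff_add_eq_zero, add_comm, ← h3]
  have hx := hKK.self_of_nhds
  simp only [localNijenhuis, h, hx, map_sub, map_add, map_neg, _root_.neg_apply]
  abel

end Nijenhuis

/-! ### The Nijenhuis tensor of `J` in coordinates -/

section LocalModel

variable {E : Type*} [NormedAddCommGroup E] [NormedSpace ℝ E] [FiniteDimensional ℝ E]
  {B : E → E →L[ℝ] E →L[ℝ] ℝ} {W : Set E} {z : E × (E →L[ℝ] ℝ)} {A : ℝ} {v : ℝ → ℝ}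

/-- The Nijenhuis tensor on horizontal vectors. -/
lemma IsMetricOn.localNijenhuis_horizontal (hB : IsMetricOn B W) (hz : z.1 ∈ W)
    (hv : ContDiffAt ℝ ∞ v (localEnergy B z)) (hG : (localG B A v z).IsInvertible) (u w : E) :
    localNijenhuis (localJ B A v) z (u, localN B z u) (w, localN B z w) =
      (0, fderiv ℝ (localG B A v) z (0, localG B A v z u) w
        - fderiv ℝ (localG B A v) z (0, localG B A v z w) u
        - (fderiv ℝ (localN B) z (u, localN B z u) w
          - fderiv ℝ (localN B) z (w, localN B z w) u)) := by
  have hNd := ((hB.contDiffAt_localN hz).differentiableAt (by simp)).hasFDerivAt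
  have hGd := ((hB.contDiffAt_localG (A := A) hz hv).differentiableAt (by simp)).hasFDerivAt
  have hX : ∀ u : E, HasFDerivAt (fun y => (u, localN B y u)) _ z := fun u =>
    (hasFDerivAt_const u z).prodMk (hNd.clm_apply (hasFDerivAt_const u z))
  have hY : ∀ u : E, HasFDerivAt (fun y => ((0 : E), localG B A v y u)) _ z := fun u =>
    (hasFDerivAt_const (0 : E) z).prodMk (hGd.clm_apply (hasFDerivAt_const u z))
  have h := lieBracket_eq_localNijenhuis
    ((hB.contDiffAt_localJ hz hv hG).differentiableAt (by simp))
    (localJ_localJ hG) (hX u).differentiableAt (hX w).differentiableAt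
  rw [← h]
  simp only [localJ_horizontal, VectorField.lieBracket, (hX u).fderiv, (hX w).fderiv,
    (hY u).fderiv, (hY w).fderiv]
  -- The vertical component of `[J δ_u, δ_w] + [δ_u, J δ_w]`. It vanishes because `G` is parallel
  -- and symmetric and the connection is torsion-free.
  have key : fderiv ℝ (localN B) z (0, localG B A v z u) w
      - fderiv ℝ (localG B A v) z (w, localN B z w) u
      + (fderiv ℝ (localG B A v) z (u, localN B z u) w
        - fderiv ℝ (localN B) z (0, localG B A v z w) u) = 0 := by
    ext x
    simp only [_root_.add_apply, _root_.sub_apply, hB.fderiv_localN hz,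
      hB.fderiv_localG_horizontal hz hv, map_zero, _root_.zero_apply]
    rw [hB.leviCivita_symm hz u w]
    have hs : ∀ u w, localG B A v z u w = localG B A v z w u := by
      intro u w
      rw [localG_apply, localG_apply, hB.symm _ hz]
      ring
    rw [hs u (leviCivita B z.1 w x), hs w (leviCivita B z.1 u x)]
    rw [hs (leviCivita B z.1 w x) u, hs (leviCivita B z.1 u x) w]
    ring
  have key' := congrArg (fun P : E →L[ℝ] ℝ => localJ B A v z (0, P)) key
  rw [show ∀ P Q : E →L[ℝ] ℝ, ((0 : E), P + Q) = (0, P) + (0, Q) by intros; simp, map_add,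
    show ((0 : E), (0 : E →L[ℝ] ℝ)) = 0 from rfl, map_zero] at key'
  simp only [ContinuousLinearMap.prod_apply, _root_.zero_apply, _root_.add_apply,
    ContinuousLinearMap.comp_apply, ContinuousLinearMap.flip_apply, map_zero, zero_add,
    Prod.mk_sub_mk, sub_self]
  rw [eq_neg_of_add_eq_zero_left key', sub_neg_eq_add, add_sub_cancel_right, Prod.mk_sub_mk,
    sub_self]

/-- Horizontal pairs suffice, by `localNijenhuis_apply_left` and antisymmetry; on them the condition
compares the bracket of the `J δ_u` with the curvature. -/
theorem IsMetricOn.localNijenhuis_eq_zero_iff (hB : IsMetricOn B W) (hz : z.1 ∈ W)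
    (hv : ContDiffAt ℝ ∞ v (localEnergy B z))
    (hG : ∀ᶠ y in 𝓝 z, (localG B A v y).IsInvertible) :
    (∀ a b, localNijenhuis (localJ B A v) z a b = 0) ↔
      ∀ u w x : E, z.2 (localCurvature B z.1 u w x) =
        A * localEnergy B z * (A + v (localEnergy B z)) *
          (z.2 u * B z.1 w x - z.2 w * B z.1 u x) := by
  have hGz := hG.self_of_nhds
  have hor : (∀ u w, localNijenhuis (localJ B A v) z (u, localN B z u) (w, localN B z w) = 0) ↔
      ∀ u w x : E, z.2 (localCurvature B z.1 u w x) =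
        A * localEnergy B z * (A + v (localEnergy B z)) *
          (z.2 u * B z.1 w x - z.2 w * B z.1 u x) := by
    simp only [hB.localNijenhuis_horizontal hz hv hGz, Prod.mk_eq_zero, true_and,
      ContinuousLinearMap.ext_iff, _root_.sub_apply, hB.fderiv_localG_vertical_sub hz hv,
      hB.fderiv_localN_horizontal_sub hz, sub_eq_zero]
    exact forall₃_congr fun _ _ _ => eq_comm
  rw [← hor]
  refine ⟨fun h u w => h _ _, fun h => ?_⟩
  have hJd := (hB.contDiffAt_localJ hz hv hGz).differentiableAt (by simp)
  have hJJ : ∀ᶠ y in 𝓝 z, ∀ a, localJ B A v y (localJ B A v y a) = -a := by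
    filter_upwards [hG] with y hy using localJ_localJ hy
  -- Since `J δ_w = (0, G w)`, the vector `w` is `G⁻¹` applied to the vertical part of `a`.
  have hdec : ∀ a : E × (E →L[ℝ] ℝ), ∃ u w : E,
      a = (u, localN B z u) + localJ B A v z (w, localN B z w) := by
    intro a
    refine ⟨a.1, (localG B A v z).inverse (a.2 - localN B z a.1), ?_⟩
    rw [localJ_horizontal, hGz.self_apply_inverse]
    ext1 <;> simp
  have h1 : ∀ (u : E) b, localNijenhuis (localJ B A v) z (u, localN B z u) b = 0 := by
    intro u b
    obtain ⟨u', w', rfl⟩ := hdec b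
    rw [localNijenhuis_swap, localNijenhuis_add_left, localNijenhuis_apply_left hJd hJJ, h, h]
    simp
  intro a b
  obtain ⟨u, w, rfl⟩ := hdec a
  rw [localNijenhuis_add_left, localNijenhuis_apply_left hJd hJJ, h1, h1]
  simp

end LocalModel

/-! ### Behaviour of the connection and of `J` under changes of coordinates -/

section ChangeOfCoordinates

variable {E : Type*} [NormedAddCommGroup E] [NormedSpace ℝ E]

/-- `b' = Lᵀ b L`, so its inverse is `L⁻¹ b⁻¹ L⁻ᵀ`. This needs no invertibility of `b`: composition
with equivalences also respects the default value `0`. -/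
lemma inverse_apply_pullback {b b' : E →L[ℝ] E →L[ℝ] ℝ} (L : E ≃L[ℝ] E)
    (h : ∀ u w, b' u w = b (L u) (L w)) (P : E →L[ℝ] ℝ) :
    b'.inverse (P.comp (L : E →L[ℝ] E)) = L.symm (b.inverse P) := by
  let e : (E →L[ℝ] ℝ) ≃L[ℝ] (E →L[ℝ] ℝ) :=
    L.symm.arrowCongr (ContinuousLinearEquiv.refl ℝ ℝ)
  have he : ∀ Q, e Q = Q.comp (L : E →L[ℝ] E) := fun Q => by
    ext w
    simp [e]
  have h' : b' = (e : (E →L[ℝ] ℝ) →L[ℝ] (E →L[ℝ] ℝ)).comp (b.comp (L : E →L[ℝ] E)) := by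
    ext u w
    simp [he, h]
  rw [h', ContinuousLinearMap.inverse_equiv_comp, ContinuousLinearMap.inverse_comp_equiv, ← he]
  simp

variable {B B' : E → E →L[ℝ] E →L[ℝ] ℝ} {W W' : Set E} {χ : E → E} {y : E}

lemma fderiv_pullback (hB : DifferentiableAt ℝ B (χ y)) (hχ : ContDiffAt ℝ ∞ χ y)
    (h : ∀ᶠ x in 𝓝 y, ∀ u w, B' x u w = B (χ x) (fderiv ℝ χ x u) (fderiv ℝ χ x w))
    (hB' : DifferentiableAt ℝ B' y) (a u w : E) :
    fderiv ℝ B' y a u w =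
      fderiv ℝ B (χ y) (fderiv ℝ χ y a) (fderiv ℝ χ y u) (fderiv ℝ χ y w)
      + B (χ y) (fderiv ℝ (fderiv ℝ χ) y a u) (fderiv ℝ χ y w)
      + B (χ y) (fderiv ℝ χ y u) (fderiv ℝ (fderiv ℝ χ) y a w) := by
  have hd : ContDiffAt ℝ ∞ (fderiv ℝ χ) y := hχ.fderiv_right (by simp)
  have hd' := (hd.differentiableAt (by simp)).hasFDerivAt
  have h1 := (hB'.hasFDerivAt.clm_apply (hasFDerivAt_const u y)).clm_apply (hasFDerivAt_const w y)
  have h2 : HasFDerivAt (fun x => B (χ x)) _ y :=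
    hB.hasFDerivAt.comp y (hχ.differentiableAt (by simp)).hasFDerivAt
  have h3 := (h2.clm_apply (hd'.clm_apply (hasFDerivAt_const u y))).clm_apply
    (hd'.clm_apply (hasFDerivAt_const w y))
  have h4 : (fun x => B' x u w) =ᶠ[𝓝 y]
      fun x => B (χ x) (fderiv ℝ χ x u) (fderiv ℝ χ x w) := by
    filter_upwards [h] with x hx using hx u w
  have h5 := congrArg (fun f => f a) (h1.unique (h3.congr_of_eventuallyEq h4))
  simp at h5
  rw [h5]
  ring

variable [FiniteDimensional ℝ E]

/-- The transformation law of the Christoffel symbols. -/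
lemma IsMetricOn.leviCivita_pullback (hB : IsMetricOn B W) (hB' : IsMetricOn B' W')
    (hy : y ∈ W') (hχy : χ y ∈ W) (hχ : ContDiffAt ℝ ∞ χ y)
    (h : ∀ᶠ x in 𝓝 y, ∀ u w, B' x u w = B (χ x) (fderiv ℝ χ x u) (fderiv ℝ χ x w))
    (L : E ≃L[ℝ] E) (hL : fderiv ℝ χ y = L) (u w : E) :
    L (leviCivita B' y u w) =
      leviCivita B (χ y) (L u) (L w) + fderiv ℝ (fderiv ℝ χ) y u w := by
  refine hB.ext hχy fun x' => ?_
  obtain ⟨x, rfl⟩ := L.surjective x'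
  have hsymm : ∀ u w, fderiv ℝ (fderiv ℝ χ) y u w = fderiv ℝ (fderiv ℝ χ) y w u :=
    fun u w => (hχ.isSymmSndFDerivAt (by
      simpa using (WithTop.coe_le_coe.2 le_top : ((2 : ℕ∞) : WithTop ℕ∞) ≤ ∞))) u w
  have h1 := h.self_of_nhds (leviCivita B' y u w) x
  have hf := fderiv_pullback (hB.differentiableAt hχy) hχ h (hB'.differentiableAt hy)
  simp only [hL, ContinuousLinearEquiv.coe_coe] at h1 hf
  -- Of the six second-derivative terms in Koszul's formula for `B'`, symmetry leaves twice
  -- `B(D²χ(u, w), L x)`.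
  rw [← h1, map_add, _root_.add_apply, hB'.leviCivita_lower hy, hB.leviCivita_lower hχy,
    hf, hf, hf, hsymm w u, hsymm x u, hsymm x w, hB.symm _ hχy (L w)]
  ring

omit [FiniteDimensional ℝ E] in
lemma localEnergy_pullback (L : E ≃L[ℝ] E) {y' : E} (hBL : ∀ u w, B' y u w = B y' (L u) (L w))
    (p : E →L[ℝ] ℝ) : localEnergy B' (y, p.comp (L : E →L[ℝ] E)) = localEnergy B (y', p) := by
  simp only [localEnergy]
  rw [inverse_apply_pullback L hBL]
  simp

/-- Naturality of `J` under changes of coordinates. -/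
lemma IsMetricOn.localJ_pullback (hB : IsMetricOn B W) (hB' : IsMetricOn B' W')
    (hy : y ∈ W') (hχy : χ y ∈ W) (hχ : ContDiffAt ℝ ∞ χ y)
    (h : ∀ᶠ x in 𝓝 y, ∀ u w, B' x u w = B (χ x) (fderiv ℝ χ x u) (fderiv ℝ χ x w))
    (L : E ≃L[ℝ] E) (hL : fderiv ℝ χ y = L) (A : ℝ) (v : ℝ → ℝ) (p : E →L[ℝ] ℝ)
    {T : E × (E →L[ℝ] ℝ) → E × (E →L[ℝ] ℝ)}
    (hT : ∀ a, T a = (L.symm a.1, a.2.comp (L : E →L[ℝ] E)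
      + p.comp (fderiv ℝ (fderiv ℝ χ) y (L.symm a.1))))
    (a : E × (E →L[ℝ] ℝ)) :
    localJ B' A v (y, p.comp (L : E →L[ℝ] E)) (T a) = T (localJ B A v (χ y, p) a) := by
  have hBL : ∀ u w, B' y u w = B (χ y) (L u) (L w) := by
    intro u w
    simpa [hL] using h.self_of_nhds u w
  have hG : ∀ u w, localG B' A v (y, p.comp (L : E →L[ℝ] E)) u w =
      localG B A v (χ y, p) (L u) (L w) := by
    intro u w
    simp [localG_apply, localEnergy_pullback L hBL, hBL]
  have hN : ∀ u, localN B' (y, p.comp (L : E →L[ℝ] E)) (L.symm u) =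
      (localN B (χ y, p) u).comp (L : E →L[ℝ] E)
        + p.comp (fderiv ℝ (fderiv ℝ χ) y (L.symm u)) := by
    intro u
    ext w
    have := hB.leviCivita_pullback hB' hy hχy hχ h L hL (L.symm u) w
    simp [localN_apply, this]
  -- The second-derivative term of `T` is the inhomogeneous term of the connection, so vertical
  -- parts transform as covectors.
  have hver : (T a).2 - localN B' (y, p.comp (L : E →L[ℝ] E)) (T a).1 =
      (a.2 - localN B (χ y, p) a.1).comp (L : E →L[ℝ] E) := by
    rw [hT]
    simp only [hN]
    ext w
    simp
  have hG' : ∀ u, localG B' A v (y, p.comp (L : E →L[ℝ] E)) (L.symm u) =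
      (localG B A v (χ y, p) u).comp (L : E →L[ℝ] E) := by
    intro u
    ext w
    simp [hG]
  simp only [localJ, swapOperator_apply, hver, inverse_apply_pullback L hG]
  simp only [hT, hG', hN]
  ext1
  · simp
  · ext w
    simp
    ring

end ChangeOfCoordinates

/-! ### Charts of `M` and the metric in them -/

section Charts

variable {E : Type*} [NormedAddCommGroup E] [NormedSpace ℝ E]
  {M : Type*} [TopologicalSpace M] [ChartedSpace E M] [IsManifold 𝓘(ℝ, E) ∞ M]

/-- The coordinate frame of `TM` given by the chart around `x₀`, at the coordinates `y`. -/
def chartFrame (x₀ : M) (y : E) : E →L[ℝ] E :=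
  mfderiv 𝓘(ℝ, E) 𝓘(ℝ, E) (extChartAt 𝓘(ℝ, E) x₀).symm y

/-- The metric at `x` as a bilinear form on the model space. -/
def metricAt (g : Metric E M) (x : M) : E →L[ℝ] E →L[ℝ] ℝ := g.inner x

lemma metricAt_symm (g : Metric E M) (x : M) (u w : E) : metricAt g x u w = metricAt g x w u :=
  g.symm x u w

lemma metricAt_pos (g : Metric E M) (x : M) {u : E} (hu : u ≠ 0) : 0 < metricAt g x u u :=
  g.pos x u hu

lemma chartMetric_apply (g : Metric E M) (x₀ : M) (y u w : E) :
    chartMetric g x₀ y u w =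
      metricAt g ((extChartAt 𝓘(ℝ, E) x₀).symm y) (chartFrame x₀ y u) (chartFrame x₀ y w) := rfl

omit [IsManifold 𝓘(ℝ, E) ∞ M] in
lemma mfderivWithin_extChartAt_symm_eq_chartFrame (x₀ : M) (y : E) :
    (mfderivWithin 𝓘(ℝ, E) 𝓘(ℝ, E) (extChartAt 𝓘(ℝ, E) x₀).symm (range 𝓘(ℝ, E)) y :
      E →L[ℝ] E) = chartFrame x₀ y := by
  have h : range 𝓘(ℝ, E) = univ := by simp
  rw [h, mfderivWithin_univ]
  rfl

lemma isInvertible_chartFrame {x₀ : M} {y : E} (hy : y ∈ (extChartAt 𝓘(ℝ, E) x₀).target) :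
    (chartFrame x₀ y).IsInvertible := by
  have : IsManifold 𝓘(ℝ, E) 1 M := .of_le (n := ∞) (by simp)
  rw [← mfderivWithin_extChartAt_symm_eq_chartFrame]
  exact isInvertible_mfderivWithin_extChartAt_symm hy

lemma chartFrame_self (x : M) :
    chartFrame x (extChartAt 𝓘(ℝ, E) x x) = ContinuousLinearMap.id ℝ E := by
  have : IsManifold 𝓘(ℝ, E) 1 M := .of_le (n := ∞) (by simp)
  rw [← mfderivWithin_extChartAt_symm_eq_chartFrame]
  exact mfderivWithin_range_extChartAt_symm

lemma chartMetric_self (g : Metric E M) (x : M) :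
    chartMetric g x (extChartAt 𝓘(ℝ, E) x x) = metricAt g x := by
  ext u w
  rw [chartMetric_apply, chartFrame_self]
  simp only [ContinuousLinearMap.id_apply]
  rw [extChartAt_to_inv]

/-- The transition map between the charts around `x₁` and `x₀`. -/
def transition (x₁ x₀ : M) : E → E :=
  extChartAt 𝓘(ℝ, E) x₀ ∘ (extChartAt 𝓘(ℝ, E) x₁).symm

lemma contDiffAt_transition {x₁ x₀ : M} {y : E} (hy : y ∈ (extChartAt 𝓘(ℝ, E) x₁).target)
    (hy' : (extChartAt 𝓘(ℝ, E) x₁).symm y ∈ (extChartAt 𝓘(ℝ, E) x₀).source) :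
    ContDiffAt ℝ ∞ (transition x₁ x₀) y := by
  have h := contDiffWithinAt_ext_coord_change (I := 𝓘(ℝ, E)) (n := ∞) x₀ x₁ (y := y)
    (by rw [PartialEquiv.trans_source]; exact ⟨hy, hy'⟩)
  have h' : range 𝓘(ℝ, E) = univ := by simp
  rw [h', contDiffWithinAt_univ] at h
  exact h

omit [IsManifold 𝓘(ℝ, E) ∞ M] in
lemma eventually_mem_transition_domain {x₁ x₀ : M} {y : E}
    (hy : y ∈ (extChartAt 𝓘(ℝ, E) x₁).target)
    (hy' : (extChartAt 𝓘(ℝ, E) x₁).symm y ∈ (extChartAt 𝓘(ℝ, E) x₀).source) :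
    ∀ᶠ x in 𝓝 y, x ∈ (extChartAt 𝓘(ℝ, E) x₁).target ∧
      (extChartAt 𝓘(ℝ, E) x₁).symm x ∈ (extChartAt 𝓘(ℝ, E) x₀).source := by
  have h1 := (isOpen_extChartAt_target (I := 𝓘(ℝ, E)) x₁).mem_nhds hy
  refine (eventually_mem_set.2 h1).and ?_
  exact (continuousAt_extChartAt_symm'' hy).eventually
    ((isOpen_extChartAt_source (I := 𝓘(ℝ, E)) x₀).mem_nhds hy')

omit [IsManifold 𝓘(ℝ, E) ∞ M] in
lemma transition_transition {x₁ x₀ : M} {y : E} (hy : y ∈ (extChartAt 𝓘(ℝ, E) x₁).target)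
    (hy' : (extChartAt 𝓘(ℝ, E) x₁).symm y ∈ (extChartAt 𝓘(ℝ, E) x₀).source) :
    transition x₀ x₁ (transition x₁ x₀ y) = y := by
  simp only [transition, Function.comp_apply]
  rw [(extChartAt 𝓘(ℝ, E) x₀).left_inv hy', (extChartAt 𝓘(ℝ, E) x₁).right_inv hy]

lemma chartFrame_transition {x₁ x₀ : M} {y : E} (hy : y ∈ (extChartAt 𝓘(ℝ, E) x₁).target)
    (hy' : (extChartAt 𝓘(ℝ, E) x₁).symm y ∈ (extChartAt 𝓘(ℝ, E) x₀).source) :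
    chartFrame x₁ y =
      (chartFrame x₀ (transition x₁ x₀ y)).comp (fderiv ℝ (transition x₁ x₀) y) := by
  have h1 : (extChartAt 𝓘(ℝ, E) x₁).symm =ᶠ[𝓝 y]
      (extChartAt 𝓘(ℝ, E) x₀).symm ∘ transition x₁ x₀ := by
    filter_upwards [eventually_mem_transition_domain hy hy'] with x hx
    exact ((extChartAt 𝓘(ℝ, E) x₀).left_inv hx.2).symm
  have h2 : MDifferentiableAt 𝓘(ℝ, E) 𝓘(ℝ, E) (transition x₁ x₀) y :=
    ((contDiffAt_transition hy hy').differentiableAt (by simp)).mdifferentiableAt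
  have hmem : transition x₁ x₀ y ∈ (extChartAt 𝓘(ℝ, E) x₀).target :=
    (extChartAt 𝓘(ℝ, E) x₀).map_source hy'
  have h3 : MDifferentiableAt 𝓘(ℝ, E) 𝓘(ℝ, E) (extChartAt 𝓘(ℝ, E) x₀).symm
      (transition x₁ x₀ y) :=
    (((contMDiffOn_extChartAt_symm (I := 𝓘(ℝ, E)) (n := ∞) x₀).contMDiffAt
      ((isOpen_extChartAt_target (I := 𝓘(ℝ, E)) x₀).mem_nhds hmem))).mdifferentiableAt (by simp)
  have h4 := mfderiv_comp y h3 h2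
  rw [← h1.mfderiv_eq] at h4
  unfold chartFrame
  refine h4.trans ?_
  rw [mfderiv_eq_fderiv]
  rfl

/-- The derivative of a transition map, as an equivalence. -/
lemma exists_equiv_fderiv_transition {x₁ x₀ : M} {y : E}
    (hy : y ∈ (extChartAt 𝓘(ℝ, E) x₁).target)
    (hy' : (extChartAt 𝓘(ℝ, E) x₁).symm y ∈ (extChartAt 𝓘(ℝ, E) x₀).source) :
    ∃ L : E ≃L[ℝ] E, fderiv ℝ (transition x₁ x₀) y = L ∧
      fderiv ℝ (transition x₀ x₁) (transition x₁ x₀ y) = L.symm := by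
  have hmem : transition x₁ x₀ y ∈ (extChartAt 𝓘(ℝ, E) x₀).target :=
    (extChartAt 𝓘(ℝ, E) x₀).map_source hy'
  have hmem' : (extChartAt 𝓘(ℝ, E) x₀).symm (transition x₁ x₀ y) ∈
      (extChartAt 𝓘(ℝ, E) x₁).source := by
    simp only [transition, Function.comp_apply]
    rw [(extChartAt 𝓘(ℝ, E) x₀).left_inv hy']
    exact (extChartAt 𝓘(ℝ, E) x₁).map_target hy
  have key : ∀ {x₁ x₀ : M} {y : E}, y ∈ (extChartAt 𝓘(ℝ, E) x₁).target →
      (extChartAt 𝓘(ℝ, E) x₁).symm y ∈ (extChartAt 𝓘(ℝ, E) x₀).source →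
      DifferentiableAt ℝ (transition x₀ x₁) (transition x₁ x₀ y) →
      (fderiv ℝ (transition x₀ x₁) (transition x₁ x₀ y)).comp (fderiv ℝ (transition x₁ x₀) y) =
        ContinuousLinearMap.id ℝ E := by
    intro x₁ x₀ y hy hy' hd
    rw [← fderiv_comp y hd ((contDiffAt_transition hy hy').differentiableAt (by simp))]
    have : transition x₀ x₁ ∘ transition x₁ x₀ =ᶠ[𝓝 y] id := by
      filter_upwards [eventually_mem_transition_domain hy hy'] with x hx
      exact transition_transition hx.1 hx.2
    rw [this.fderiv_eq, fderiv_id]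
  have h1 := key hy hy' ((contDiffAt_transition hmem hmem').differentiableAt (by simp))
  have h2 := key hmem hmem' (by
    rw [transition_transition hy hy']
    exact (contDiffAt_transition hy hy').differentiableAt (by simp))
  rw [transition_transition hy hy'] at h2
  exact ⟨ContinuousLinearEquiv.equivOfInverse' _ _ h2 h1, rfl, rfl⟩

lemma chartMetric_transition (g : Metric E M) {x₁ x₀ : M} {y : E}
    (hy : y ∈ (extChartAt 𝓘(ℝ, E) x₁).target)
    (hy' : (extChartAt 𝓘(ℝ, E) x₁).symm y ∈ (extChartAt 𝓘(ℝ, E) x₀).source) (u w : E) :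
    chartMetric g x₁ y u w = chartMetric g x₀ (transition x₁ x₀ y)
      (fderiv ℝ (transition x₁ x₀) y u) (fderiv ℝ (transition x₁ x₀) y w) := by
  rw [chartMetric_apply, chartMetric_apply, chartFrame_transition hy hy']
  have h : (extChartAt 𝓘(ℝ, E) x₀).symm (transition x₁ x₀ y) =
      (extChartAt 𝓘(ℝ, E) x₁).symm y := (extChartAt 𝓘(ℝ, E) x₀).left_inv hy'
  rw [h]
  rfl

lemma symmL_trivializationAt_eq_chartFrame {x₀ x : M}
    (hx : x ∈ (extChartAt 𝓘(ℝ, E) x₀).source) :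
    ((trivializationAt E (TangentSpace 𝓘(ℝ, E)) x₀).symmL ℝ x : E →L[ℝ] E) =
      chartFrame x₀ (extChartAt 𝓘(ℝ, E) x₀ x) := by
  have : IsManifold 𝓘(ℝ, E) 1 M := .of_le (n := ∞) (by simp)
  rw [← mfderivWithin_extChartAt_symm_eq_chartFrame]
  exact TangentBundle.symmL_trivializationAt (by simpa using hx)

/-- Smoothness of `g` as a section is smoothness in the trivialization of the bundle of bilinear
forms, where its expression is `chartMetric` because the tangent trivialization is inverse to the
coordinate frame. -/
lemma contDiffOn_chartMetric (g : Metric E M) (x₀ : M) :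
    ContDiffOn ℝ ∞ (chartMetric g x₀) (extChartAt 𝓘(ℝ, E) x₀).target := by
  have : IsManifold 𝓘(ℝ, E) 1 M := .of_le (n := ∞) (by simp)
  set e := trivializationAt (E →L[ℝ] E →L[ℝ] ℝ)
    (fun x : M => TangentSpace 𝓘(ℝ, E) x →L[ℝ] TangentSpace 𝓘(ℝ, E) x →L[ℝ] ℝ) x₀ with he
  have hb : e.baseSet = (extChartAt 𝓘(ℝ, E) x₀).source := by
    simp [he]
  have h1 : ContMDiffOn 𝓘(ℝ, E) 𝓘(ℝ, E →L[ℝ] E →L[ℝ] ℝ) ∞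
      (fun x => (e ⟨x, g.inner x⟩).2) (extChartAt 𝓘(ℝ, E) x₀).source := by
    rw [← hb]
    exact (Trivialization.contMDiffOn_section_baseSet_iff (IB := 𝓘(ℝ, E)) (n := ∞) e
      (s := g.inner)).1 g.contMDiff.contMDiffOn
  have h2 := h1.comp (contMDiffOn_extChartAt_symm (I := 𝓘(ℝ, E)) (n := ∞) x₀)
    (fun y hy => (extChartAt 𝓘(ℝ, E) x₀).map_target hy)
  refine (contMDiffOn_iff_contDiffOn.1 h2).congr fun y hy => ?_
  have hx := (extChartAt 𝓘(ℝ, E) x₀).map_target hy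
  have hx' : (extChartAt 𝓘(ℝ, E) x₀).symm y ∈
      (trivializationAt E (TangentSpace 𝓘(ℝ, E)) x₀).baseSet := by
    simpa using hx
  have hs := symmL_trivializationAt_eq_chartFrame hx
  rw [(extChartAt 𝓘(ℝ, E) x₀).right_inv hy] at hs
  ext u w
  have hsymm : ∀ u : E, ((trivializationAt E (TangentSpace 𝓘(ℝ, E)) x₀).symm
      ((extChartAt 𝓘(ℝ, E) x₀).symm y) u : E) = chartFrame x₀ y u := fun u =>
    (Trivialization.symmL_apply (R := ℝ) _ hx' u).symm.trans (congrArg (fun f => f u) hs)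
  have h3 := inCoordinates_apply_eq₂ (𝕜 := ℝ) (x₀ := x₀) (F₁ := E) (F₂ := E) (F₃ := ℝ)
    (E₁ := fun x : M => TangentSpace 𝓘(ℝ, E) x) (E₂ := fun x : M => TangentSpace 𝓘(ℝ, E) x)
    (E₃ := Bundle.Trivial M ℝ) (ϕ := g.inner ((extChartAt 𝓘(ℝ, E) x₀).symm y))
    (v := u) (w := w) hx' hx' (by simp)
  simp only [Trivial.fiberBundle_trivializationAt', Trivial.linearMapAt_trivialization,
    LinearMap.id_coe, id_eq] at h3
  refine Eq.trans ?_ h3.symm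
  rw [chartMetric_apply, ← hsymm, ← hsymm]
  rfl

lemma isMetricOn_chartMetric (g : Metric E M) (x₀ : M) :
    IsMetricOn (chartMetric g x₀) (extChartAt 𝓘(ℝ, E) x₀).target where
  isOpen := isOpen_extChartAt_target x₀
  contDiffOn := contDiffOn_chartMetric g x₀
  symm y _ u w := by rw [chartMetric_apply, chartMetric_apply, metricAt_symm]
  pos y hy u hu := by
    rw [chartMetric_apply]
    refine metricAt_pos _ _ fun h => hu ?_
    obtain ⟨e, he⟩ := isInvertible_chartFrame hy
    apply e.injective
    rw [map_zero, ← h, ← he]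
    rfl

end Charts

/-! ### Charts of `T^*M` and the derivatives of their transition maps -/

section CotangentCharts

variable {E : Type*} [NormedAddCommGroup E] [NormedSpace ℝ E]
  {M : Type*} [TopologicalSpace M] [ChartedSpace E M] [IsManifold 𝓘(ℝ, E) ∞ M]

/-- The covector `ξ` as an element of the model fibre. -/
def momentum (ξ : Cotangent E M) : E →L[ℝ] ℝ := ξ.2

/-- The chart of the cotangent bundle, with values in the model space. -/
def cotChart (ξ : Cotangent E M) : PartialEquiv (Cotangent E M) (E × (E →L[ℝ] ℝ)) :=
  extChartAt (cotModel E) ξ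

/-- The trivialization of the cotangent bundle over the chart around `x`. -/
def cotTrivialization (x : M) : Trivialization (E →L[ℝ] ℝ) (TotalSpace.proj :
    Cotangent E M → M) :=
  trivializationAt (E →L[ℝ] ℝ)
    (fun x : M ↦ TangentSpace 𝓘(ℝ, E) x →L[ℝ] Bundle.Trivial M ℝ x) x

lemma cotTrivialization_baseSet (x : M) :
    (cotTrivialization (E := E) x).baseSet = (extChartAt 𝓘(ℝ, E) x).source := by
  simp [cotTrivialization]

lemma cotChart_eq (ξ : Cotangent E M) :
    cotChart ξ = (cotTrivialization ξ.1).toPartialEquiv ≫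
      (extChartAt 𝓘(ℝ, E) ξ.1).prod (PartialEquiv.refl (E →L[ℝ] ℝ)) :=
  FiberBundle.extChartAt ξ

lemma cotChart_source (ξ : Cotangent E M) :
    (cotChart ξ).source = {η | η.1 ∈ (extChartAt 𝓘(ℝ, E) ξ.1).source} := by
  ext η
  rw [cotChart_eq, PartialEquiv.trans_source, PartialEquiv.prod_source]
  have h : (cotTrivialization ξ.1).source =
      {η : Cotangent E M | η.1 ∈ (extChartAt 𝓘(ℝ, E) ξ.1).source} := by
    rw [(cotTrivialization ξ.1).source_eq, cotTrivialization_baseSet]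
    rfl
  rw [h]
  have h2 : η.1 ∈ (extChartAt 𝓘(ℝ, E) ξ.1).source → ((cotTrivialization ξ.1) η).1 = η.1 :=
    fun h' => (cotTrivialization ξ.1).coe_fst (by rw [h]; exact h')
  constructor
  · exact fun h => h.1
  · refine fun h' => ⟨h', ?_, trivial⟩
    change ((cotTrivialization ξ.1) η).1 ∈ _
    rw [h2 h']
    exact h'

lemma cotChart_target (ξ : Cotangent E M) :
    (cotChart ξ).target = {z | z.1 ∈ (extChartAt 𝓘(ℝ, E) ξ.1).target} := by
  have h := FiberBundle.extChartAt_target (IB := 𝓘(ℝ, E)) (F := E →L[ℝ] ℝ)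
    (E := fun x : M ↦ TangentSpace 𝓘(ℝ, E) x →L[ℝ] Bundle.Trivial M ℝ x) ξ
  refine h.trans ?_
  ext z
  have hb := cotTrivialization_baseSet (E := E) ξ.1
  constructor
  · exact fun h => h.1.1
  · refine fun h => ⟨⟨h, ?_⟩, trivial⟩
    change _ ∈ (cotTrivialization ξ.1).baseSet
    rw [hb]
    exact (extChartAt 𝓘(ℝ, E) ξ.1).map_target h

/-- The fibre coordinates of a covector are its values on the coordinate frame: these are the
classical `(q, p)`. -/
lemma cotChart_apply (ξ η : Cotangent E M) (h : η.1 ∈ (extChartAt 𝓘(ℝ, E) ξ.1).source) :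
    cotChart ξ η = (extChartAt 𝓘(ℝ, E) ξ.1 η.1,
      (momentum η).comp (chartFrame ξ.1 (extChartAt 𝓘(ℝ, E) ξ.1 η.1))) := by
  have h1 : cotChart ξ η = (extChartAt 𝓘(ℝ, E) ξ.1 η.1,
      (ContinuousLinearMap.inCoordinates E (fun x : M => TangentSpace 𝓘(ℝ, E) x) ℝ
        (Bundle.Trivial M ℝ) ξ.1 η.1 ξ.1 η.1 η.2 : E →L[ℝ] ℝ)) := by
    rw [cotChart_eq]
    rfl
  rw [h1, ← symmL_trivializationAt_eq_chartFrame h]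
  unfold ContinuousLinearMap.inCoordinates
  simp only [Trivial.fiberBundle_trivializationAt', Trivial.continuousLinearMapAt_trivialization]
  rfl

lemma cotChart_self (ξ : Cotangent E M) :
    cotChart ξ ξ = (extChartAt 𝓘(ℝ, E) ξ.1 ξ.1, momentum ξ) := by
  rw [cotChart_apply ξ ξ (mem_extChartAt_source ξ.1), chartFrame_self]
  rfl

lemma cotChart_symm_proj (ξ : Cotangent E M) {z : E × (E →L[ℝ] ℝ)} (hz : z ∈ (cotChart ξ).target) :
    ((cotChart ξ).symm z).1 = (extChartAt 𝓘(ℝ, E) ξ.1).symm z.1 := by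
  have h1 := (cotChart ξ).map_target hz
  rw [cotChart_source] at h1
  have h2 := congrArg Prod.fst ((cotChart_apply ξ _ h1).symm.trans ((cotChart ξ).right_inv hz))
  simp only at h2
  rw [← h2, (extChartAt 𝓘(ℝ, E) ξ.1).left_inv h1]

lemma momentum_comp_chartFrame (ξ : Cotangent E M) {z : E × (E →L[ℝ] ℝ)}
    (hz : z ∈ (cotChart ξ).target) :
    (momentum ((cotChart ξ).symm z)).comp (chartFrame ξ.1 z.1) = z.2 := by
  have h1 := (cotChart ξ).map_target hz
  rw [cotChart_source] at h1
  have h2 := (cotChart_apply ξ _ h1).symm.trans ((cotChart ξ).right_inv hz)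
  have h3 := congrArg Prod.fst h2
  have h4 := congrArg Prod.snd h2
  simp only at h3 h4
  rw [h3] at h4
  exact h4

/-- The transition map between the charts of the cotangent bundle around `ξ` and `η`. -/
lemma cotChart_comp_symm (ξ η : Cotangent E M) {z : E × (E →L[ℝ] ℝ)}
    (hz : z ∈ (cotChart ξ).target)
    (hz' : (extChartAt 𝓘(ℝ, E) ξ.1).symm z.1 ∈ (extChartAt 𝓘(ℝ, E) η.1).source) :
    cotChart η ((cotChart ξ).symm z) = (transition ξ.1 η.1 z.1,
      z.2.comp (fderiv ℝ (transition η.1 ξ.1) (transition ξ.1 η.1 z.1))) := by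
  have hp := cotChart_symm_proj ξ hz
  have hz1 : z.1 ∈ (extChartAt 𝓘(ℝ, E) ξ.1).target := by
    rw [cotChart_target] at hz
    exact hz
  rw [cotChart_apply η _ (by rw [hp]; exact hz'), hp]
  have h1 : extChartAt 𝓘(ℝ, E) η.1 ((extChartAt 𝓘(ℝ, E) ξ.1).symm z.1) =
    transition ξ.1 η.1 z.1 := rfl
  have hmem : transition ξ.1 η.1 z.1 ∈ (extChartAt 𝓘(ℝ, E) η.1).target :=
    (extChartAt 𝓘(ℝ, E) η.1).map_source hz'
  have hmem' : (extChartAt 𝓘(ℝ, E) η.1).symm (transition ξ.1 η.1 z.1) ∈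
      (extChartAt 𝓘(ℝ, E) ξ.1).source := by
    rw [← h1, (extChartAt 𝓘(ℝ, E) η.1).left_inv hz']
    exact (extChartAt 𝓘(ℝ, E) ξ.1).map_target hz1
  rw [h1, chartFrame_transition hmem hmem', transition_transition hz1 hz',
    ← ContinuousLinearMap.comp_assoc, momentum_comp_chartFrame ξ hz]

/-- The coordinate frame of the tangent bundle of `T^*M` given by the chart around `ξ`. -/
def cotFrame (ξ : Cotangent E M) (z : E × (E →L[ℝ] ℝ)) :
    E × (E →L[ℝ] ℝ) →L[ℝ] E × (E →L[ℝ] ℝ) :=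
  mfderivWithin 𝓘(ℝ, E × (E →L[ℝ] ℝ)) (cotModel E) (extChartAt (cotModel E) ξ).symm
    (range (cotModel E)) z

lemma isInvertible_cotFrame (ξ : Cotangent E M) {z : E × (E →L[ℝ] ℝ)}
    (hz : z ∈ (cotChart ξ).target) : (cotFrame ξ z).IsInvertible := by
  have : IsManifold (cotModel E) 1 (Cotangent E M) := .of_le (n := ∞) (by simp)
  exact isInvertible_mfderivWithin_extChartAt_symm hz

/-- A tangent space of `T^*M` is identified with the model by the preferred chart at its own base
point, so the frame is the derivative of a transition map into that chart. -/
lemma cotFrame_eq_fderiv (ξ : Cotangent E M) {z : E × (E →L[ℝ] ℝ)}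
    (hz : z ∈ (cotChart ξ).target) :
    cotFrame ξ z = fderiv ℝ (cotChart ((cotChart ξ).symm z) ∘ (cotChart ξ).symm) z := by
  have : IsManifold (cotModel E) 1 (Cotangent E M) := .of_le (n := ∞) (by simp)
  have h := mdifferentiableWithinAt_extChartAt_symm (I := cotModel E) (x := ξ) hz
  have hr : range (cotModel E) = univ := by simp
  have h2 : cotFrame ξ z = _ := h.mfderivWithin
  rw [h2, ← fderivWithin_univ, hr]
  simp only [preimage_univ, univ_inter, modelWithCornersSelf_coe, range_id]
  rfl

/-- The derivative of the transition maps of the cotangent bundle. -/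
lemma cotFrame_apply (ξ : Cotangent E M) {z : E × (E →L[ℝ] ℝ)}
    (hz : z ∈ (cotChart ξ).target) {x₁ : M} (hx₁ : ((cotChart ξ).symm z).1 = x₁) {L : E ≃L[ℝ] E}
    (hL : fderiv ℝ (transition x₁ ξ.1) (extChartAt 𝓘(ℝ, E) x₁ x₁) = L)
    (hL' : fderiv ℝ (transition ξ.1 x₁) z.1 = L.symm) (a : E × (E →L[ℝ] ℝ)) :
    cotFrame ξ z a = (L.symm a.1, a.2.comp (L : E →L[ℝ] E) +
      z.2.comp (fderiv ℝ (fderiv ℝ (transition x₁ ξ.1)) (extChartAt 𝓘(ℝ, E) x₁ x₁)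
        (L.symm a.1))) := by
  have hz1 : z.1 ∈ (extChartAt 𝓘(ℝ, E) ξ.1).target := by
    rw [cotChart_target] at hz
    exact hz
  have hx : (extChartAt 𝓘(ℝ, E) ξ.1).symm z.1 = x₁ := by rw [← cotChart_symm_proj ξ hz, hx₁]
  have hxs : (extChartAt 𝓘(ℝ, E) ξ.1).symm z.1 ∈ (extChartAt 𝓘(ℝ, E) x₁).source := by
    rw [hx]
    exact mem_extChartAt_source x₁
  have hψz : transition ξ.1 x₁ z.1 = extChartAt 𝓘(ℝ, E) x₁ x₁ := by
    rw [transition, Function.comp_apply, hx]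
  have hχ : ContDiffAt ℝ ∞ (transition x₁ ξ.1) (transition ξ.1 x₁ z.1) := by
    rw [hψz]
    refine contDiffAt_transition (mem_extChartAt_target x₁) ?_
    rw [extChartAt_to_inv, ← hx]
    exact (extChartAt 𝓘(ℝ, E) ξ.1).map_target hz1
  have hev : cotChart ((cotChart ξ).symm z) ∘ (cotChart ξ).symm =ᶠ[𝓝 z]
      fun z' => (transition ξ.1 x₁ z'.1,
        z'.2.comp (fderiv ℝ (transition x₁ ξ.1) (transition ξ.1 x₁ z'.1))) := by
    have h1 := continuousAt_fst.eventually (eventually_mem_transition_domain hz1 hxs)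
    filter_upwards [h1] with z' hz'
    subst hx₁
    exact cotChart_comp_symm ξ _ (by rw [cotChart_target]; exact hz'.1) hz'.2
  have hψd : HasFDerivAt (fun z' : E × (E →L[ℝ] ℝ) => transition ξ.1 x₁ z'.1)
      ((L.symm : E →L[ℝ] E).comp (ContinuousLinearMap.fst ℝ E (E →L[ℝ] ℝ))) z := by
    rw [← hL']
    exact (((contDiffAt_transition hz1 hxs).differentiableAt (by simp)).hasFDerivAt).comp z
      hasFDerivAt_fst
  -- The coefficient of `p` in the transition map is itself a first derivative; differentiating it
  -- produces the second-order term.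
  have hχd := ((hχ.fderiv_right (m := ∞) (by simp)).differentiableAt (by simp)).hasFDerivAt
  have hχψ : HasFDerivAt (fun z' : E × (E →L[ℝ] ℝ) =>
      fderiv ℝ (transition x₁ ξ.1) (transition ξ.1 x₁ z'.1)) _ z := hχd.comp z hψd
  have hd := hψd.prodMk (hasFDerivAt_snd.clm_comp hχψ)
  rw [cotFrame_eq_fderiv ξ hz, hev.fderiv_eq, HasFDerivAt.fderiv hd, hψz, hL]
  ext1
  · rfl
  · ext w
    simp [add_comm]

end CotangentCharts

/-! ### From `T^*M` to coordinates: integrability as a curvature identity -/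

section Integrability

variable {E : Type*} [NormedAddCommGroup E] [NormedSpace ℝ E]
  {M : Type*} [TopologicalSpace M] [ChartedSpace E M] [IsManifold 𝓘(ℝ, E) ∞ M]

lemma energy_eq_localEnergy (g : Metric E M) (η : Cotangent E M) :
    energy g η = localEnergy (chartMetric g η.1) (cotChart η η) := by
  rw [cotChart_self]
  unfold localEnergy
  rw [chartMetric_self]
  rfl

/-- The chart used here varies with `η`, so by itself this identifies `J` only at the centre of each
chart. -/
lemma J_eq_localJ (g : Metric E M) (A : ℝ) (v : ℝ → ℝ) (η : Cotangent E M) :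
    J g A v η = localJ (chartMetric g η.1) A v (cotChart η η) := by
  have hG : tensorG g A v η = localG (chartMetric g η.1) A v (cotChart η η) := by
    unfold localG
    rw [← energy_eq_localEnergy, cotChart_self, chartMetric_self]
    rfl
  have hN : horizontal g η = localN (chartMetric g η.1) (cotChart η η) := by
    rw [cotChart_self]
    rfl
  unfold J localJ tensorH
  rw [hG, hN]
  rfl

/-- The transition map between the charts around `ξ` and around a point of the chart of `ξ`. -/
lemma exists_transition_equiv (ξ : Cotangent E M) {z : E × (E →L[ℝ] ℝ)}
    (hz : z ∈ (cotChart ξ).target) {η : Cotangent E M} (hη : (cotChart ξ).symm z = η) :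
    extChartAt 𝓘(ℝ, E) η.1 η.1 ∈ (extChartAt 𝓘(ℝ, E) η.1).target ∧
    (extChartAt 𝓘(ℝ, E) η.1).symm (extChartAt 𝓘(ℝ, E) η.1 η.1) ∈
      (extChartAt 𝓘(ℝ, E) ξ.1).source ∧
    transition η.1 ξ.1 (extChartAt 𝓘(ℝ, E) η.1 η.1) = z.1 ∧
    ∃ L : E ≃L[ℝ] E,
      fderiv ℝ (transition η.1 ξ.1) (extChartAt 𝓘(ℝ, E) η.1 η.1) = L ∧
      fderiv ℝ (transition ξ.1 η.1) z.1 = L.symm ∧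
      cotChart η η = (extChartAt 𝓘(ℝ, E) η.1 η.1, z.2.comp (L : E →L[ℝ] E)) := by
  have hz1 : z.1 ∈ (extChartAt 𝓘(ℝ, E) ξ.1).target := by
    rw [cotChart_target] at hz
    exact hz
  have hx : (extChartAt 𝓘(ℝ, E) ξ.1).symm z.1 = η.1 := by rw [← cotChart_symm_proj ξ hz, hη]
  have hs : (extChartAt 𝓘(ℝ, E) η.1).symm (extChartAt 𝓘(ℝ, E) η.1 η.1) ∈
      (extChartAt 𝓘(ℝ, E) ξ.1).source := by
    rw [extChartAt_to_inv, ← hx]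
    exact (extChartAt 𝓘(ℝ, E) ξ.1).map_target hz1
  have hχ : transition η.1 ξ.1 (extChartAt 𝓘(ℝ, E) η.1 η.1) = z.1 := by
    rw [transition, Function.comp_apply, extChartAt_to_inv, ← hx,
      (extChartAt 𝓘(ℝ, E) ξ.1).right_inv hz1]
  have hψ : transition ξ.1 η.1 z.1 = extChartAt 𝓘(ℝ, E) η.1 η.1 := by
    rw [transition, Function.comp_apply, hx]
  obtain ⟨L, hL, hL'⟩ := exists_equiv_fderiv_transition (mem_extChartAt_target η.1) hs
  rw [hχ] at hL'
  refine ⟨mem_extChartAt_target η.1, hs, hχ, L, hL, hL', ?_⟩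
  have h := cotChart_comp_symm ξ η hz (by rw [hx]; exact mem_extChartAt_source η.1)
  rw [hη, hψ, hL] at h
  exact h

lemma energy_cotChart_symm (g : Metric E M) (ξ : Cotangent E M) {z : E × (E →L[ℝ] ℝ)}
    (hz : z ∈ (cotChart ξ).target) :
    energy g ((cotChart ξ).symm z) = localEnergy (chartMetric g ξ.1) z := by
  obtain ⟨ht, hs, hχ, L, hL, hL', hc⟩ := exists_transition_equiv ξ hz rfl
  rw [energy_eq_localEnergy, hc]
  refine localEnergy_pullback L (y' := z.1) (fun u w => ?_) z.2
  rw [chartMetric_transition g ht hs, hχ, hL]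
  rfl

/-- A vector field on the cotangent bundle, read in the chart around `ξ`. -/
def inChart (ξ : Cotangent E M) (X : Cotangent E M → E × (E →L[ℝ] ℝ)) (z : E × (E →L[ℝ] ℝ)) :
    E × (E →L[ℝ] ℝ) :=
  (cotFrame ξ z).inverse (X ((cotChart ξ).symm z))

lemma cotFrame_self (ξ : Cotangent E M) :
    cotFrame ξ (cotChart ξ ξ) = ContinuousLinearMap.id ℝ (E × (E →L[ℝ] ℝ)) := by
  have : IsManifold (cotModel E) 1 (Cotangent E M) := .of_le (n := ∞) (by simp)
  exact mfderivWithin_range_extChartAt_symm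

lemma inChart_self (ξ : Cotangent E M) (X : Cotangent E M → E × (E →L[ℝ] ℝ)) :
    inChart ξ X (cotChart ξ ξ) = X ξ := by
  have h : (cotChart ξ).symm (cotChart ξ ξ) = ξ := extChartAt_to_inv ξ
  rw [inChart, cotFrame_self, ContinuousLinearMap.inverse_id, h]
  rfl

/-- No derivative of the chart remains, because at its own centre that derivative is the identity.
-/
lemma mlieBracket_eq_lieBracket_inChart (ξ : Cotangent E M)
    (X Y : ∀ ξ : Cotangent E M, TangentSpace (cotModel E) ξ) :
    VectorField.mlieBracket (cotModel E) X Y ξ =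
      VectorField.lieBracket ℝ (inChart ξ X) (inChart ξ Y) (cotChart ξ ξ) := by
  have : IsManifold (cotModel E) 1 (Cotangent E M) := .of_le (n := ∞) (by simp)
  have hr : range (cotModel E) = univ := by simp
  let D : E × (E →L[ℝ] ℝ) →L[ℝ] E × (E →L[ℝ] ℝ) :=
    mfderiv (cotModel E) 𝓘(ℝ, E × (E →L[ℝ] ℝ)) (extChartAt (cotModel E) ξ) ξ
  have h1 : D = ContinuousLinearMap.id ℝ _ := mfderiv_extChartAt_self
  have h2 : VectorField.mlieBracket (cotModel E) X Y ξ = D.inverse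
      (VectorField.lieBracketWithin ℝ (inChart ξ X) (inChart ξ Y)
        ((extChartAt (cotModel E) ξ).symm ⁻¹' univ ∩ range (cotModel E)) (cotChart ξ ξ)) := rfl
  rw [h2, h1, ContinuousLinearMap.inverse_id, hr, preimage_univ, univ_inter,
    VectorField.lieBracketWithin_univ]
  rfl

variable [FiniteDimensional ℝ E]

lemma isInvertible_localG_chartMetric (g : Metric E M) {S : Set ℝ} (hS_pos : S ⊆ Ioi 0) {A : ℝ}
    {v : ℝ → ℝ} (hA : A ≠ 0) (hAv : ∀ t ∈ S, A + 2 * v t ≠ 0) (x : M) {z : E × (E →L[ℝ] ℝ)}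
    (hz : z.1 ∈ (extChartAt 𝓘(ℝ, E) x).target) (ht : localEnergy (chartMetric g x) z ∈ S) :
    (localG (chartMetric g x) A v z).IsInvertible :=
  (isMetricOn_chartMetric g x).isInvertible_localG hz hA (hS_pos ht) (hAv _ ht)

/-- Extends the coordinate description of `J` from the centre to the whole chart around `ξ`, by
naturality under the transition to the chart centred at `η`. Only then can `J` be differentiated in
coordinates. -/
lemma cotFrame_localJ (g : Metric E M) (A : ℝ) (v : ℝ → ℝ) (ξ : Cotangent E M)
    {z : E × (E →L[ℝ] ℝ)} (hz : z ∈ (cotChart ξ).target) {η : Cotangent E M}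
    (hη : (cotChart ξ).symm z = η) (a : E × (E →L[ℝ] ℝ)) :
    localJ (chartMetric g η.1) A v (cotChart η η) (cotFrame ξ z a) =
      cotFrame ξ z (localJ (chartMetric g ξ.1) A v z a) := by
  obtain ⟨ht, hs, hχ, L, hL, hL', hc⟩ := exists_transition_equiv ξ hz hη
  have hz1 : z.1 ∈ (extChartAt 𝓘(ℝ, E) ξ.1).target := by
    rw [cotChart_target] at hz
    exact hz
  have hT := cotFrame_apply ξ hz (congrArg TotalSpace.proj hη) hL hL'
  have h := (isMetricOn_chartMetric g ξ.1).localJ_pullback (isMetricOn_chartMetric g η.1)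
    (y := extChartAt 𝓘(ℝ, E) η.1 η.1) (χ := transition η.1 ξ.1) ht (by rw [hχ]; exact hz1)
    (contDiffAt_transition ht hs)
    (by
      filter_upwards [eventually_mem_transition_domain ht hs] with x hx u w
      exact chartMetric_transition g hx.1 hx.2 u w) L hL A v z.2 hT a
  rw [hc, h, hχ]

lemma inChart_J (g : Metric E M) (A : ℝ) (v : ℝ → ℝ) (ξ : Cotangent E M)
    (X : Cotangent E M → E × (E →L[ℝ] ℝ))
    {z : E × (E →L[ℝ] ℝ)} (hz : z ∈ (cotChart ξ).target) :
    inChart ξ (fun η => localJ (chartMetric g η.1) A v (cotChart η η) (X η)) z =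
      localJ (chartMetric g ξ.1) A v z (inChart ξ X z) := by
  have hF := isInvertible_cotFrame ξ hz
  have h := cotFrame_localJ g A v ξ hz rfl (inChart ξ X z)
  have h1 : cotFrame ξ z (inChart ξ X z) = X ((cotChart ξ).symm z) := by
    rw [inChart, hF.self_apply_inverse]
  rw [h1] at h
  rw [inChart, h, hF.inverse_apply_self]

omit [FiniteDimensional ℝ E] in
lemma cotChart_target_mem_nhds (ξ : Cotangent E M) : (cotChart ξ).target ∈ 𝓝 (cotChart ξ ξ) := by
  have h := (isOpen_extChartAt_target (I := cotModel E) ξ).mem_nhds (mem_extChartAt_target ξ)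
  exact h

lemma differentiableAt_inChart (ξ : Cotangent E M)
    (X : ∀ ξ : Cotangent E M, TangentSpace (cotModel E) ξ)
    (hX : MDifferentiableAt (cotModel E) (cotModel E).tangent
      (fun ξ ↦ (⟨ξ, X ξ⟩ : TangentBundle (cotModel E) (Cotangent E M))) ξ) :
    DifferentiableAt ℝ (inChart ξ X) (cotChart ξ ξ) := by
  have : IsManifold (cotModel E) 2 (Cotangent E M) :=
    .of_le (n := ∞) (WithTop.coe_le_coe.2 le_top : ((2 : ℕ∞) : WithTop ℕ∞) ≤ ∞)
  have hr : range (cotModel E) = univ := by simp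
  have h := MDifferentiableWithinAt.differentiableWithinAt_mpullbackWithin_vectorField
    (mdifferentiableWithinAt_univ.2 hX)
  have h2 : DifferentiableWithinAt ℝ (inChart ξ X)
      ((extChartAt (cotModel E) ξ).symm ⁻¹' univ ∩ range (cotModel E)) (cotChart ξ ξ) := h
  rwa [hr, preimage_univ, univ_inter, differentiableWithinAt_univ] at h2

/-- The Nijenhuis tensor of `J` is given by its expression in coordinates. -/
theorem nijenhuis_J_eq (g : Metric E M) {S : Set ℝ} (hS : IsOpen S) (hS_pos : S ⊆ Ioi 0) {A : ℝ}
    {v : ℝ → ℝ} (hv : ContDiffOn ℝ ∞ v S) (hA : A ≠ 0) (hAv : ∀ t ∈ S, A + 2 * v t ≠ 0)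
    {ξ : Cotangent E M} (hξ : ξ ∈ tube g S)
    {X Y : ∀ ξ : Cotangent E M, TangentSpace (cotModel E) ξ}
    (hX : MDifferentiableAt (cotModel E) (cotModel E).tangent
      (fun ξ ↦ (⟨ξ, X ξ⟩ : TangentBundle (cotModel E) (Cotangent E M))) ξ)
    (hY : MDifferentiableAt (cotModel E) (cotModel E).tangent
      (fun ξ ↦ (⟨ξ, Y ξ⟩ : TangentBundle (cotModel E) (Cotangent E M))) ξ) :
    nijenhuis (J g A v) X Y ξ =
      localNijenhuis (localJ (chartMetric g ξ.1) A v) (cotChart ξ ξ) (X ξ) (Y ξ) := by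
  have hB := isMetricOn_chartMetric g ξ.1
  have ht : localEnergy (chartMetric g ξ.1) (cotChart ξ ξ) ∈ S := by
    rw [← energy_eq_localEnergy]
    exact hξ
  have hz : (cotChart ξ ξ).1 ∈ (extChartAt 𝓘(ℝ, E) ξ.1).target := by
    rw [cotChart_self]
    exact mem_extChartAt_target ξ.1
  have hG := isInvertible_localG_chartMetric g hS_pos hA hAv ξ.1 hz ht
  have hJ := (hB.contDiffAt_localJ hz (hv.contDiffAt (hS.mem_nhds ht)) hG).differentiableAt
    (by simp)
  let X' : Cotangent E M → E × (E →L[ℝ] ℝ) := X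
  let Y' : Cotangent E M → E × (E →L[ℝ] ℝ) := Y
  have hJev : ∀ X : Cotangent E M → E × (E →L[ℝ] ℝ),
      inChart ξ (fun η => localJ (chartMetric g η.1) A v (cotChart η η) (X η))
        =ᶠ[𝓝 (cotChart ξ ξ)] fun z => localJ (chartMetric g ξ.1) A v z (inChart ξ X z) := by
    intro X
    filter_upwards [cotChart_target_mem_nhds ξ] with z hz using inChart_J g A v ξ X hz
  have h := lieBracket_eq_localNijenhuis (X := inChart ξ X') (Y := inChart ξ Y') hJ
    (localJ_localJ hG) (differentiableAt_inChart ξ X hX) (differentiableAt_inChart ξ Y hY)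
  rw [inChart_self ξ X', inChart_self ξ Y',
    ← (hJev X').lieBracket_vectorField_eq (𝕜 := ℝ) (hJev Y'),
    ← (hJev X').lieBracket_vectorField_eq (𝕜 := ℝ) (EventuallyEq.refl _ (inChart ξ Y')),
    ← (EventuallyEq.refl _ (inChart ξ X')).lieBracket_vectorField_eq (𝕜 := ℝ) (hJev Y')] at h
  have hJ' : ∀ X : ∀ ξ : Cotangent E M, TangentSpace (cotModel E) ξ,
      (fun η => J g A v η (X η)) =
        (fun η => localJ (chartMetric g η.1) A v (cotChart η η) (X η) :
          Cotangent E M → E × (E →L[ℝ] ℝ)) := by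
    intro X
    funext η
    exact congrArg (fun f : E × (E →L[ℝ] ℝ) →L[ℝ] E × (E →L[ℝ] ℝ) => f (X η))
      (J_eq_localJ g A v η)
  have hbr : ∀ X Y : ∀ ξ : Cotangent E M, TangentSpace (cotModel E) ξ,
      ∀ X' Y' : Cotangent E M → E × (E →L[ℝ] ℝ), X = X' → Y = Y' →
      VectorField.mlieBracket (cotModel E) X Y ξ =
        VectorField.lieBracket ℝ (inChart ξ X') (inChart ξ Y') (cotChart ξ ξ) := by
    rintro X Y _ _ rfl rfl
    exact mlieBracket_eq_lieBracket_inChart ξ X Y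
  have e1 := hbr _ _ _ _ (hJ' X) (hJ' Y)
  have e2 := hbr _ Y _ Y' (hJ' X) rfl
  have e3 := hbr X _ X' _ rfl (hJ' Y)
  have e4 := hbr X Y X' Y' rfl rfl
  unfold nijenhuis
  rw [e1, e2, e3, e4, J_eq_localJ]
  exact h

lemma isOpen_tube (g : Metric E M) {S : Set ℝ} (hS : IsOpen S) : IsOpen (tube g S) := by
  rw [isOpen_iff_mem_nhds]
  intro ξ hξ
  have hz : (cotChart ξ ξ).1 ∈ (extChartAt 𝓘(ℝ, E) ξ.1).target := by
    rw [cotChart_self]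
    exact mem_extChartAt_target ξ.1
  have h1 : ContinuousAt (fun η => localEnergy (chartMetric g ξ.1) (cotChart ξ η)) ξ :=
    ((isMetricOn_chartMetric g ξ.1).contDiffAt_localEnergy hz).continuousAt.comp
      (continuousAt_extChartAt ξ)
  have h2 : localEnergy (chartMetric g ξ.1) (cotChart ξ ξ) ∈ S := by
    rw [← energy_eq_localEnergy]
    exact hξ
  have h3 : (cotChart ξ).source ∈ 𝓝 ξ := extChartAt_source_mem_nhds ξ
  filter_upwards [h1.preimage_mem_nhds (hS.mem_nhds h2), h3] with η hη hη'
  have h4 := energy_cotChart_symm g ξ ((cotChart ξ).map_source hη')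
  rw [(cotChart ξ).left_inv hη'] at h4
  change energy g η ∈ S
  rw [h4]
  exact hη

/-- The integrability condition, as an identity for the curvature tensor. -/
theorem isIntegrableOn_tube_iff (g : Metric E M) {S : Set ℝ} (hS : IsOpen S) (hS_pos : S ⊆ Ioi 0)
    {A : ℝ} {v : ℝ → ℝ} (hv : ContDiffOn ℝ ∞ v S) (hA : A ≠ 0)
    (hAv : ∀ t ∈ S, A + 2 * v t ≠ 0) :
    IsIntegrableOn (J g A v) (tube g S) ↔ ∀ ξ ∈ tube g S, ∀ u w x : E,
      momentum ξ (localCurvature (chartMetric g ξ.1) (extChartAt 𝓘(ℝ, E) ξ.1 ξ.1) u w x) =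
        A * energy g ξ * (A + v (energy g ξ)) *
          (momentum ξ u * metricAt g ξ.1 w x - momentum ξ w * metricAt g ξ.1 u x) := by
  have key : ∀ ξ ∈ tube g S, ((∀ a b, localNijenhuis (localJ (chartMetric g ξ.1) A v)
      (cotChart ξ ξ) a b = 0) ↔ ∀ u w x : E,
      momentum ξ (localCurvature (chartMetric g ξ.1) (extChartAt 𝓘(ℝ, E) ξ.1 ξ.1) u w x) =
        A * energy g ξ * (A + v (energy g ξ)) *
          (momentum ξ u * metricAt g ξ.1 w x - momentum ξ w * metricAt g ξ.1 u x)) := by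
    intro ξ hξ
    have hB := isMetricOn_chartMetric g ξ.1
    have ht : localEnergy (chartMetric g ξ.1) (cotChart ξ ξ) ∈ S := by
      rw [← energy_eq_localEnergy]
      exact hξ
    have hz : (cotChart ξ ξ).1 ∈ (extChartAt 𝓘(ℝ, E) ξ.1).target := by
      rw [cotChart_self]
      exact mem_extChartAt_target ξ.1
    have hG : ∀ᶠ y in 𝓝 (cotChart ξ ξ), (localG (chartMetric g ξ.1) A v y).IsInvertible := by
      filter_upwards [cotChart_target_mem_nhds ξ,
        (hB.contDiffAt_localEnergy hz).continuousAt.preimage_mem_nhds (hS.mem_nhds ht)] with y hy hy'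
      rw [cotChart_target] at hy
      exact isInvertible_localG_chartMetric g hS_pos hA hAv ξ.1 hy hy'
    rw [hB.localNijenhuis_eq_zero_iff hz (hv.contDiffAt (hS.mem_nhds ht)) hG,
      ← energy_eq_localEnergy, cotChart_self, chartMetric_self]
  -- Integrability is stated for vector fields; extending single vectors to local smooth fields
  -- yields the pointwise condition.
  have hext : ∀ (ξ : Cotangent E M) (a : E × (E →L[ℝ] ℝ)),
      ∃ X : ∀ ξ : Cotangent E M, TangentSpace (cotModel E) ξ, X ξ = a ∧ ∃ s ∈ 𝓝 ξ,
        ContMDiffOn (cotModel E) (cotModel E).tangent ∞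
          (fun ξ ↦ (⟨ξ, X ξ⟩ : TangentBundle (cotModel E) (Cotangent E M))) s := fun ξ a =>
    ⟨FiberBundle.extend (E × (E →L[ℝ] ℝ)) (x := ξ) a, FiberBundle.extend_apply_self _ _,
      FiberBundle.exists_contMDiffOn_extend (cotModel E) _ _⟩
  constructor
  · intro h ξ hξ
    refine (key ξ hξ).1 fun a b => ?_
    obtain ⟨X, hX, s, hs, hXs⟩ := hext ξ a
    obtain ⟨Y, hY, s', hs', hYs⟩ := hext ξ b
    have hV : IsOpen (tube g S ∩ (interior s ∩ interior s')) :=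
      (isOpen_tube g hS).inter (isOpen_interior.inter isOpen_interior)
    have hξV : ξ ∈ tube g S ∩ (interior s ∩ interior s') :=
      ⟨hξ, mem_interior_iff_mem_nhds.2 hs, mem_interior_iff_mem_nhds.2 hs'⟩
    have h1 := h _ hV inter_subset_left _ _
      (hXs.mono fun _ hx => interior_subset hx.2.1) (hYs.mono fun _ hx => interior_subset hx.2.2)
      ξ hξV
    rw [nijenhuis_J_eq g hS hS_pos hv hA hAv hξ
      ((hXs.contMDiffAt hs).mdifferentiableAt (by simp))
      ((hYs.contMDiffAt hs').mdifferentiableAt (by simp)), hX, hY] at h1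
    exact h1
  · intro h V hV hVS X Y hX hY ξ hξ
    rw [nijenhuis_J_eq g hS hS_pos hv hA hAv (hVS hξ)
      ((hX.contMDiffAt (hV.mem_nhds hξ)).mdifferentiableAt (by simp))
      ((hY.contMDiffAt (hV.mem_nhds hξ)).mdifferentiableAt (by simp))]
    exact (key ξ (hVS hξ)).2 (h ξ (hVS hξ)) _ _

end Integrability

/-! ### Symmetries of the curvature tensor, and its determination by sectional curvatures -/

section Curvature

variable {E : Type*} [NormedAddCommGroup E] [NormedSpace ℝ E]

/-- A tensor with the symmetries of a curvature tensor vanishes if its sectional curvatures do. -/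
lemma eq_zero_of_curvature_symmetries {V : Type*} [Add V] {T : V → V → V → V → ℝ}
    (hadd₁ : ∀ u u' w x y, T (u + u') w x y = T u w x y + T u' w x y)
    (hadd₂ : ∀ u w w' x y, T u (w + w') x y = T u w x y + T u w' x y)
    (hadd₃ : ∀ u w x x' y, T u w (x + x') y = T u w x y + T u w x' y)
    (hadd₄ : ∀ u w x y y', T u w x (y + y') = T u w x y + T u w x y')
    (hanti : ∀ u w x y, T w u x y = -T u w x y) (hskew : ∀ u w x, T u w x x = 0)
    (hbianchi : ∀ u w x y, T u w x y + T w x u y + T x u w y = 0)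
    (hsec : ∀ u w, T u w w u = 0) (u w x y : V) : T u w x y = 0 := by
  have hskew' : ∀ u w x y, T u w y x = -T u w x y := by
    intro u w x y
    have h := hskew u w (x + y)
    rw [hadd₃, hadd₄, hadd₄, hskew, hskew] at h
    linarith
  -- The four Bianchi identities on `u, w, x, y` combine with the two skew-symmetries to give pair
  -- symmetry.
  have hpair : ∀ u w x y, T u w x y = T x y u w := by
    intro u w x y
    have h1 := hbianchi u w x y
    have h2 := hbianchi w x y u
    have h3 := hbianchi x y u w
    have h4 := hbianchi y u w x
    linarith [hskew' w x u y, hskew' x u w y, hskew' u w x y, hanti u x w y, hanti u x y w,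
      hskew' x y u w, hskew' y u w x, hskew' w y u x, hanti w y x u, hskew' y u x w,
      hskew' y w x u, hskew' w x y u, hskew' x u y w, hanti x u y w, hanti y w x u, hanti y w u x]
  -- Polarization in the outer argument, then in `h2` in the inner one; after that the three Bianchi
  -- terms coincide, so `3 T = 0`.
  have h1 : ∀ u w y, T u w w y = 0 := by
    intro u w y
    have h := hsec (u + y) w
    rw [hadd₁, hadd₄, hadd₄, hsec, hsec] at h
    have h' : T y w w u = T u w w y := by
      rw [hpair, hanti, hskew']
      ring
    linarith
  have h2 : ∀ u w x y, T u x w y = -T u w x y := by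
    intro u w x y
    have h := h1 u (w + x) y
    rw [hadd₂, hadd₃, hadd₃, h1, h1] at h
    linarith
  have h3 := hbianchi u w x y
  have h4 : T x u w y = T u w x y := by rw [hanti, h2, neg_neg]
  have h5 : T w x u y = T u w x y := by rw [h2, hanti, neg_neg]
  linarith

/-- The nonzero vector `b(u, u) w - b(u, w) u` has squared length `b(u, u)` times the Gram
determinant. -/
lemma gram_pos {b : E →L[ℝ] E →L[ℝ] ℝ} (hsymm : ∀ u w, b u w = b w u)
    (hpos : ∀ u, u ≠ 0 → 0 < b u u) {u w : E} (h : LinearIndependent ℝ ![u, w]) :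
    0 < b u u * b w w - b u w ^ 2 := by
  have hu : u ≠ 0 := by simpa using h.ne_zero 0
  have hx : b u u • w - b u w • u ≠ 0 := by
    intro hx
    have := (LinearIndependent.pair_iff.1 h (-(b u w)) (b u u) (by rw [← hx]; module)).2
    exact (hpos u hu).ne' this
  have h1 := hpos _ hx
  have h2 : b (b u u • w - b u w • u) (b u u • w - b u w • u) =
      b u u * (b u u * b w w - b u w ^ 2) := by
    simp only [map_sub, map_smul, _root_.sub_apply, _root_.smul_apply, smul_eq_mul, hsymm w u]
    ring
  rw [h2] at h1
  exact pos_of_mul_pos_right h1 (hpos u hu).le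

variable {B : E → E →L[ℝ] E →L[ℝ] ℝ} {W : Set E} {y : E}

lemma localCurvature_swap (u w x : E) :
    localCurvature B y w u x = -localCurvature B y u w x := by
  simp only [localCurvature]
  abel

variable [FiniteDimensional ℝ E]

/-- The first Bianchi identity. -/
lemma IsMetricOn.localCurvature_cyclic (hB : IsMetricOn B W) (hy : y ∈ W) (u w x : E) :
    localCurvature B y u w x + localCurvature B y w x u + localCurvature B y x u w = 0 := by
  have hΓ := ((hB.contDiffAt_leviCivita hy).differentiableAt (by simp)).hasFDerivAt
  have hs : ∀ u w x, fderiv ℝ (leviCivita B) y u w x = fderiv ℝ (leviCivita B) y u x w := by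
    intro u w x
    have h1 := (hΓ.clm_apply (hasFDerivAt_const w y)).clm_apply (hasFDerivAt_const x y)
    have h2 := (hΓ.clm_apply (hasFDerivAt_const x y)).clm_apply (hasFDerivAt_const w y)
    have h3 : (fun q => leviCivita B q w x) =ᶠ[𝓝 y] fun q => leviCivita B q x w := by
      filter_upwards [hB.isOpen.mem_nhds hy] with q hq using hB.leviCivita_symm hq w x
    have h4 := congrArg (fun f => f u) (h1.unique (h2.congr_of_eventuallyEq h3))
    simpa using h4
  simp only [localCurvature]
  rw [hs u x w, hs w u x, hs x w u, hB.leviCivita_symm hy x w, hB.leviCivita_symm hy u x,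
    hB.leviCivita_symm hy w u]
  abel

/-- The curvature operators are skew-adjoint. -/
lemma IsMetricOn.localCurvature_skew (hB : IsMetricOn B W) (hy : y ∈ W) (u w x : E) :
    B y (localCurvature B y u w x) x = 0 := by
  have hΓ := ((hB.contDiffAt_leviCivita hy).differentiableAt (by simp)).hasFDerivAt
  have hd := (hB.differentiableAt hy).hasFDerivAt
  have hdd := (((hB.contDiffAt hy).fderiv_right (m := ∞) (by simp)).differentiableAt
    (by simp)).hasFDerivAt
  -- Derivative of `D_u B(x, x) = 2 B(Γ(u, x), x)`. Symmetry of second derivatives in `u`, `w` then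
  -- gives the claim.
  have key : ∀ u w, fderiv ℝ (fderiv ℝ B) y w u x x =
      2 * (fderiv ℝ B y w (leviCivita B y u x) x + B y (fderiv ℝ (leviCivita B) y w u x) x) := by
    intro u w
    have hc : ∀ e : E, HasFDerivAt (fun _ : E => e) (0 : E →L[ℝ] E) y := fun e =>
      hasFDerivAt_const e y
    have h1 := ((hdd.clm_apply (hc u)).clm_apply (hc x)).clm_apply (hc x)
    have h2 := ((hd.clm_apply ((hΓ.clm_apply (hc u)).clm_apply (hc x))).clm_apply
      (hc x)).const_mul (2 : ℝ)
    have h3 : (fun q => fderiv ℝ B q u x x) =ᶠ[𝓝 y]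
        fun q => 2 * B q (leviCivita B q u x) x := by
      filter_upwards [hB.isOpen.mem_nhds hy] with q hq
      rw [hB.fderiv_eq hq, hB.symm q hq x]
      ring
    have h4 := congrArg (fun f => f w) (h1.unique (h2.congr_of_eventuallyEq h3))
    simp at h4
    rw [h4]
    ring
  have hsymm := congrArg (fun b : E →L[ℝ] E →L[ℝ] ℝ => b x x)
    (((hB.contDiffAt hy).isSymmSndFDerivAt (by
      simpa using (WithTop.coe_le_coe.2 le_top : ((2 : ℕ∞) : WithTop ℕ∞) ≤ ∞))) u w)
  simp only [key, hB.fderiv_eq hy] at hsymm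
  simp only [localCurvature, map_add, map_sub, _root_.add_apply, _root_.sub_apply]
  rw [hB.symm y hy (leviCivita B y u x) (leviCivita B y w x)] at hsymm
  linarith

/-- The difference from the constant curvature model has all curvature symmetries and zero sectional
curvatures, so it vanishes. -/
lemma IsMetricOn.localCurvature_eq_of_sectional (hB : IsMetricOn B W) (hy : y ∈ W) {c : ℝ}
    (h : ∀ u w, B y (localCurvature B y u w w) u =
      c * (B y u u * B y w w - B y u w ^ 2)) (u w x : E) :
    localCurvature B y u w x = c • (B y w x • u - B y u x • w) := by
  refine hB.ext hy fun x' => ?_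
  have h0 := eq_zero_of_curvature_symmetries (T := fun u w x x' =>
    B y (localCurvature B y u w x) x' - c * (B y w x * B y u x' - B y u x * B y w x'))
    (by
      intro u u' w x x'
      simp only [localCurvature, map_add, map_sub, _root_.add_apply, _root_.sub_apply]
      ring)
    (by
      intro u w w' x x'
      simp only [localCurvature, map_add, map_sub, _root_.add_apply, _root_.sub_apply]
      ring)
    (by
      intro u w x x' x''
      simp only [localCurvature, map_add, map_sub, _root_.add_apply, _root_.sub_apply]
      ring)
    (by
      intro u w x x' x''
      simp only [map_add]
      ring)
    (by
      intro u w x x'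
      simp only [localCurvature_swap u w, map_neg, _root_.neg_apply]
      ring)
    (by
      intro u w x
      rw [hB.localCurvature_skew hy]
      ring)
    (by
      intro u w x x'
      have := congrArg (fun e => B y e x') (hB.localCurvature_cyclic hy u w x)
      simp only [map_add, _root_.add_apply, map_zero, _root_.zero_apply] at this
      rw [hB.symm y hy x u, hB.symm y hy w u, hB.symm y hy x w]
      linarith)
    (by
      intro u w
      rw [h, hB.symm y hy w u]
      ring) u w x x'
  simp only [map_smul, map_sub, _root_.smul_apply, _root_.sub_apply, smul_eq_mul]
  linarith

end Curvature

/-! ### Constant sectional curvature on `M` -/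

section ConstantCurvature

variable {E : Type*} [NormedAddCommGroup E] [NormedSpace ℝ E] [FiniteDimensional ℝ E]
  {M : Type*} [TopologicalSpace M] [ChartedSpace E M] [IsManifold 𝓘(ℝ, E) ∞ M]

/-- The curvature tensor at `x`, as a trilinear operation on the model space. -/
def curvatureAt (g : Metric E M) (x : M) : E → E → E → E :=
  localCurvature (chartMetric g x) (extChartAt 𝓘(ℝ, E) x x)

lemma hasConstantSectionalCurvature_iff (g : Metric E M) (c : ℝ) :
    HasConstantSectionalCurvature g c ↔ ∀ (x : M) (u w z : E),
      curvatureAt g x u w z = c • (metricAt g x w z • u - metricAt g x u z • w) := by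
  have hdef : HasConstantSectionalCurvature g c ↔ ∀ (x : M) (u w : E),
      LinearIndependent ℝ ![u, w] → metricAt g x (curvatureAt g x u w w) u /
        (metricAt g x u u * metricAt g x w w - metricAt g x u w ^ 2) = c := Iff.rfl
  have hgram : ∀ (x : M) {u w : E}, LinearIndependent ℝ ![u, w] →
      0 < metricAt g x u u * metricAt g x w w - metricAt g x u w ^ 2 := fun x u w h =>
    gram_pos (metricAt_symm g x) (fun u hu => metricAt_pos g x hu) h
  rw [hdef]
  constructor
  · intro h x
    have hB := isMetricOn_chartMetric g x
    have hy := mem_extChartAt_target (I := 𝓘(ℝ, E)) x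
    rw [← chartMetric_self]
    refine hB.localCurvature_eq_of_sectional hy fun u w => ?_
    rw [chartMetric_self]
    change metricAt g x (curvatureAt g x u w w) u = _
    by_cases hi : LinearIndependent ℝ ![u, w]
    · rw [← h x u w hi]
      field_simp [(hgram x hi).ne']
    -- For dependent pairs, where the sectional curvature is undefined, both sides vanish.
    · have hself : ∀ u z, curvatureAt g x u u z = 0 := by
        intro u z
        simp [curvatureAt, localCurvature]
      have hsmul : ∀ (k : ℝ) u w z, curvatureAt g x u (k • w) z = k • curvatureAt g x u w z := by
        intro k u w z
        simp only [curvatureAt, localCurvature, map_smul, _root_.smul_apply, smul_sub, smul_add]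
      by_cases hu : u = 0
      · subst hu
        simp
      · rw [LinearIndependent.pair_iff' hu] at hi
        push Not at hi
        obtain ⟨k, rfl⟩ := hi
        rw [hsmul, hself]
        simp
        right
        ring
  · intro h x u w hi
    rw [h, div_eq_iff (hgram x hi).ne']
    simp only [map_smul, map_sub, _root_.smul_apply, _root_.sub_apply, smul_eq_mul]
    rw [metricAt_symm g x w u]
    ring

omit [FiniteDimensional ℝ E] in
lemma energy_smul (g : Metric E M) (x : M) (s : ℝ) (P : E →L[ℝ] ℝ) :
    energy g (⟨x, s • P⟩ : Cotangent E M) = s ^ 2 * energy g (⟨x, P⟩ : Cotangent E M) := by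
  have h : ∀ P : E →L[ℝ] ℝ, energy g (⟨x, P⟩ : Cotangent E M) =
      1 / 2 * P ((metricAt g x).inverse P) := fun P => rfl
  rw [h, h, map_smul, _root_.smul_apply, map_smul, smul_eq_mul, smul_eq_mul]
  ring

lemma energy_pos (g : Metric E M) (x : M) {P : E →L[ℝ] ℝ} (hP : P ≠ 0) :
    0 < energy g (⟨x, P⟩ : Cotangent E M) := by
  rw [energy_eq_localEnergy, (isMetricOn_chartMetric g x).localEnergy_pos_iff]
  · rw [cotChart_self]
    exact hP
  · rw [cotChart_self]
    exact mem_extChartAt_target x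

/-- The curvature tensor of `(M, g)` when `J` is integrable. -/
lemma curvatureAt_eq_of_forall_tube (g : Metric E M) {S : Set ℝ} (hS_pos : S ⊆ Ioi 0)
    {f : ℝ → ℝ} (h : ∀ ξ ∈ tube g S, ∀ u w x : E, momentum ξ (curvatureAt g ξ.1 u w x) =
      f (energy g ξ) * (momentum ξ u * metricAt g ξ.1 w x - momentum ξ w * metricAt g ξ.1 u x))
    {t : ℝ} (ht : t ∈ S) (x : M) (u w z : E) :
    curvatureAt g x u w z = f t • (metricAt g x w z • u - metricAt g x u z • w) := by
  have hB := isMetricOn_chartMetric g x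
  have hy := mem_extChartAt_target (I := 𝓘(ℝ, E)) x
  have hP : ∀ P : E →L[ℝ] ℝ, P (curvatureAt g x u w z) =
      P (f t • (metricAt g x w z • u - metricAt g x u z • w)) := by
    intro P
    by_cases hP : P = 0
    · simp [hP]
    have he := energy_pos g x hP
    -- The energy is quadratic on fibres, so this factor moves `P` to the level `t`; the identity is
    -- linear in `P` once the energy is fixed.
    set s := √(t / energy g (⟨x, P⟩ : Cotangent E M)) with hs
    have ht0 : 0 < t := hS_pos ht
    have hs0 : s ≠ 0 := (Real.sqrt_pos.2 (div_pos ht0 he)).ne'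
    have hes : energy g (⟨x, s • P⟩ : Cotangent E M) = t := by
      rw [energy_smul, hs, Real.sq_sqrt (div_pos ht0 he).le]
      field_simp
    have h1 := h ⟨x, s • P⟩ (by change energy g _ ∈ S; rw [hes]; exact ht) u w z
    rw [hes] at h1
    have h2 : s * P (curvatureAt g x u w z) =
        f t * (s * P u * metricAt g x w z - s * P w * metricAt g x u z) := h1
    apply mul_left_cancel₀ hs0
    rw [h2]
    simp only [map_smul, map_sub, smul_eq_mul]
    ring
  refine hB.ext hy fun x' => ?_
  rw [hB.symm _ hy, hB.symm _ hy _ x']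
  exact hP _

end ConstantCurvature

end CotangentJ

end

/-! ### The main theorem -/

theorem theorem3
    {E : Type*} [NormedAddCommGroup E] [NormedSpace ℝ E] [FiniteDimensional ℝ E]
    (hn : 2 ≤ Module.finrank ℝ E)
    {M : Type*} [TopologicalSpace M] [ChartedSpace E M] [IsManifold 𝓘(ℝ, E) ∞ M] [Nonempty M]
    (g : CotangentJ.Metric E M)
    (S : Set ℝ) (hS : IsOpen S) (hS_ne : S.Nonempty) (hS_pos : S ⊆ Set.Ioi 0)
    (A : ℝ) (v : ℝ → ℝ) (hv : ContDiffOn ℝ ∞ v S)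
    (hA : A ≠ 0) (hAv : ∀ t ∈ S, A + 2 * v t ≠ 0) :
    CotangentJ.IsIntegrableOn (CotangentJ.J g A v) (CotangentJ.tube g S) ↔
      ∃ c : ℝ, CotangentJ.HasConstantSectionalCurvature g c ∧
        ∀ t ∈ S, v t = (c - A ^ 2 * t) / (A * t) := by
  open CotangentJ in
  rw [isIntegrableOn_tube_iff g hS hS_pos hv hA hAv]
  have hf : ∀ t ∈ S, ∀ c, v t = (c - A ^ 2 * t) / (A * t) ↔ A * t * (A + v t) = c := by
    intro t ht c
    have ht0 : t ≠ 0 := (hS_pos ht).ne'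
    rw [eq_div_iff (mul_ne_zero hA ht0)]
    constructor <;> intro h <;> linarith
  constructor
  · intro h
    have hR : ∀ t ∈ S, ∀ (x : M) (u w z : E), curvatureAt g x u w z =
        (A * t * (A + v t)) • (metricAt g x w z • u - metricAt g x u z • w) := fun t ht x u w z =>
      curvatureAt_eq_of_forall_tube g hS_pos (f := fun t => A * t * (A + v t)) h ht x u w z
    obtain ⟨t₀, ht₀⟩ := hS_ne
    refine ⟨A * t₀ * (A + v t₀), (hasConstantSectionalCurvature_iff g _).2 (hR t₀ ht₀),
      fun t ht => (hf t ht _).2 ?_⟩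
    obtain ⟨x⟩ := ‹Nonempty M›
    -- A linearly independent pair has nonzero Gram determinant, which can be cancelled to compare
    -- the coefficients at `t` and `t₀`.
    have : Nontrivial E := Module.nontrivial_of_finrank_pos (R := ℝ) (by omega)
    obtain ⟨u, hu⟩ := exists_ne (0 : E)
    obtain ⟨w, hi⟩ := exists_linearIndependent_pair_of_one_lt_finrank (R := ℝ) (by omega) hu
    have hg := gram_pos (metricAt_symm g x) (fun u hu => metricAt_pos g x hu) hi
    have h1 := congrArg (fun e => metricAt g x e u)
      ((hR t ht x u w w).symm.trans (hR t₀ ht₀ x u w w))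
    simp only [map_smul, map_sub, _root_.smul_apply, _root_.sub_apply, smul_eq_mul] at h1
    rw [metricAt_symm g x w u] at h1
    apply mul_right_cancel₀ hg.ne'
    linarith
  · rintro ⟨c, hc, hvc⟩ ξ hξ u w x
    have h1 := (hasConstantSectionalCurvature_iff g c).1 hc ξ.1 u w x
    have h2 := (hf _ hξ c).1 (hvc _ hξ)
    rw [h2]
    refine (congrArg (momentum ξ) h1).trans ?_
    simp only [map_smul, map_sub, smul_eq_mul]
    ring
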